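/- There is a universal constant $C>0$ such that the following holds. Let $\epsilon,\delta\in(0,1)$, let $N\ge 1$, and let $G_1,\dots,G_N$ be directed graphs without self-loops on a common finite vertex set $V$, with adjacency matrices $A_1,\dots,A_N\in\{0,1\}^{V\times V}$, where $(A_i)_{vw}=1$ if and only if $(v,w)$ is an edge of $G_i$. Let $d$ be a natural number with $$d\ \ge\ C\,\frac{\log N+\log(1/\delta)}{\epsilon^2},$$ let $P$ be a random real $d\times V$ matrix whose columns $(p_v)_{v\in V}$ are independent and uniformly distributed on the unit sphere $\mathbb S^{d-1}\subset\mathbb R^d$, and put $\pi(A)=PAP^{T}\in\mathbb R^{d\times d}$. Then, with probability at least $1-\delta$, $$(1-\epsilon)\,\|A_i-A_j\|_F^2\ \le\ \|\pi(A_i)-\pi(A_j)\|_F^2\ \le\ (1+\epsilon)\,\|A_i-A_j\|_F^2\qquad\text{for all } i,j\in\{1,\dots,N\},$$ where $\|\cdot\|_F$ is the Frobenius norm. In particular, for each fixed failure probability $\delta$ and all $N\ge2$, a dimension $d=\Omega(\log N/\epsilon^2)$ suffices, with an implied constant that depends only on $\delta$ (not on $|V|$, the graphs, $N$ or $\epsilon$).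 -/

import Mathlib

open scoped Matrix Matrix.Norms.Frobenius

namespace GraphJL

/-- The unit sphere `S^{d-1}` of the Euclidean space `ℝ^d`. -/
abbrev UnitSphere (d : ℕ) : Type :=
  Metric.sphere (0 : EuclideanSpace ℝ (Fin d)) 1

/-- The uniform distribution on `S^{d-1}`: the surface measure induced by Lebesgue measure,
normalised to have total mass one. -/
noncomputable def uniformSphere (d : ℕ) : MeasureTheory.Measure (UnitSphere d) :=
  ((MeasureTheory.volume : MeasureTheory.Measure (EuclideanSpace ℝ (Fin d))).toSphere Set.univ)⁻¹ •
    (MeasureTheory.volume : MeasureTheory.Measure (EuclideanSpace ℝ (Fin d))).toSphere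

/-- For `d ≥ 1` the uniform distribution on the sphere is a probability measure. -/
theorem isProbabilityMeasure_uniformSphere (d : ℕ) (hd : 1 ≤ d) :
    MeasureTheory.IsProbabilityMeasure (uniformSphere d) := by
  have : Nonempty (Fin d) := ⟨⟨0, hd⟩⟩
  refine ⟨?_⟩
  have h0 : (MeasureTheory.volume : MeasureTheory.Measure
      (EuclideanSpace ℝ (Fin d))).toSphere Set.univ ≠ 0 := by
    rw [Ne, MeasureTheory.Measure.measure_univ_eq_zero]
    exact MeasureTheory.Measure.toSphere_ne_zero _
  simp only [uniformSphere, MeasureTheory.Measure.smul_apply, smul_eq_mul]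
  exact ENNReal.inv_mul_cancel h0 (MeasureTheory.measure_ne_top _ _)

open Classical in
/-- The adjacency matrix of a directed graph: the entry at `(v, w)` is `1` if there is an edge
from `v` to `w`, and `0` otherwise. -/
noncomputable def adjMatrix {V : Type*} (G : Digraph V) : Matrix V V ℝ :=
  Matrix.of fun v w => if G.Adj v w then 1 else 0

/-- The `d × V` matrix whose column at the vertex `v` is the vector `p v` of `S^{d-1}`. -/
def codeMatrix {V : Type*} {d : ℕ} (p : V → UnitSphere d) : Matrix (Fin d) V ℝ :=
  Matrix.of fun k v => (p v : EuclideanSpace ℝ (Fin d)) k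

/-- The projection `π(A) = P A Pᵀ`. -/
def project {V : Type*} [Fintype V] {d : ℕ} (P : Matrix (Fin d) V ℝ) (A : Matrix V V ℝ) :
    Matrix (Fin d) (Fin d) ℝ :=
  P * A * Pᵀ

end GraphJL

/-! Put `B = A i - A j`, a matrix with zero diagonal. Expanding, `‖P B Pᵀ‖²` is the sum of `B v w *
B v' w' * ⟨p v, p v'⟩ * ⟨p w, p w'⟩` over four indices, and the terms with `v = v'`, `w = w'` add up
to `‖B‖²`. It suffices that the remainder has `L^q` norm at most a constant times `√(q/d) * ‖B‖²`
for all `q ≤ d` (`eLpNorm_quartic_sub_le`): Markov's inequality at order `q ≈ 2 log N + log (1/δ)`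
then gives failure probability `exp (-q)` per pair, which survives the union bound over `N²` pairs.

The moment bound rests on decoupling. A linear form in one uniform point of the sphere is
sub-Gaussian with variance proxy of order `1/d`, by a volume bound for caps. A quadratic chaos is an
average over subsets `S` of inner products between a combination of points in `S` and one of points
outside `S`; given the latter, this is a sum of independent sub-Gaussian variables
(`eLpNorm_chaos_le`). For the quartic form, averaging over `S` with rows in `S` and columns outside
reduces the generic terms to quadratic chaoses with coefficients fixed by the outside points
(`eLpNorm_blockChaos_le`). Index coincidences leave only row and column chaoses, chain terms and
squared Gram entries, each bounded separately; `quartic_sub_eq` is the exact bookkeeping. -/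

namespace GraphJL

open MeasureTheory ProbabilityTheory

/-! ### Concentration on the sphere -/

open scoped Pointwise in
/-- A spherical cap seen at height `s` has uniform measure at most `(1 - s²) ^ (d / 2)`. -/
theorem uniformSphere_cap_le_sqrt_pow {d : ℕ} (hd : 1 ≤ d) (x : EuclideanSpace ℝ (Fin d))
    (hx : ‖x‖ = 1) {s : ℝ} (hs0 : 0 ≤ s) (hs : 2 * s ^ 2 ≤ 1) :
    uniformSphere d {θ | s ≤ inner ℝ x (θ : EuclideanSpace ℝ (Fin d))} ≤
      ENNReal.ofReal (Real.sqrt (1 - s ^ 2) ^ d) := by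
  have : Nonempty (Fin d) := ⟨⟨0, hd⟩⟩
  set S : Set (UnitSphere d) := {θ | s ≤ inner ℝ x (θ : EuclideanSpace ℝ (Fin d))} with hS
  have hSm : MeasurableSet S := by
    apply IsClosed.measurableSet
    exact isClosed_le continuous_const (by fun_prop)
  -- The surface measure of the cap is `d` times the volume of the cone over it, and that cone fits
  -- in a ball of radius `√(1 - s²)` about `s • x`. At the apex this needs `s² ≤ 1 - s²`, whence the
  -- restriction on `s`.
  have hsub : Set.Ioo (0 : ℝ) 1 • ((↑) '' S : Set (EuclideanSpace ℝ (Fin d))) ⊆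
      Metric.closedBall (s • x) (Real.sqrt (1 - s ^ 2)) := by
    rintro _ ⟨r, ⟨hr0, hr1⟩, _, ⟨θ, hθ, rfl⟩, rfl⟩
    rw [Metric.mem_closedBall, dist_eq_norm]
    apply Real.le_sqrt_of_sq_le
    have hθ1 : ‖(θ : EuclideanSpace ℝ (Fin d))‖ = 1 := by simp
    have hθs : s ≤ inner ℝ x (θ : EuclideanSpace ℝ (Fin d)) := hθ
    simp only
    rw [@norm_sub_sq_real, norm_smul, norm_smul, hθ1, hx, real_inner_smul_left,
      real_inner_smul_right, real_inner_comm, Real.norm_eq_abs, Real.norm_eq_abs, mul_one, mul_one,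
      sq_abs, sq_abs]
    have h1 : r * (s * s) ≤ r * (s * inner ℝ x (θ : EuclideanSpace ℝ (Fin d))) := by gcongr
    nlinarith [mul_pos hr0 (sub_pos.2 hr1)]
  have hball0 : volume (Metric.ball (0 : EuclideanSpace ℝ (Fin d)) 1) ≠ 0 :=
    (Metric.isOpen_ball.measure_pos _ (by simp)).ne'
  have hballt : volume (Metric.ball (0 : EuclideanSpace ℝ (Fin d)) 1) ≠ ⊤ :=
    measure_ball_lt_top.ne
  have hd0 : ((d : ℕ) : ENNReal) ≠ 0 := by
    rw [Nat.cast_ne_zero]; omega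
  rw [uniformSphere, Measure.smul_apply, Measure.toSphere_apply' _ hSm, Measure.toSphere_apply_univ,
    finrank_euclideanSpace_fin, smul_eq_mul]
  calc _ ≤ ((d : ENNReal) * volume (Metric.ball (0 : EuclideanSpace ℝ (Fin d)) 1))⁻¹ *
        (d * (ENNReal.ofReal (Real.sqrt (1 - s ^ 2) ^ d) *
          volume (Metric.ball (0 : EuclideanSpace ℝ (Fin d)) 1))) := by
        gcongr
        refine (measure_mono hsub).trans_eq ?_
        rw [Measure.addHaar_closedBall _ _ (Real.sqrt_nonneg _), finrank_euclideanSpace_fin]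
    _ = _ := by
        rw [mul_left_comm (d : ENNReal), ← mul_assoc, mul_comm _ (ENNReal.ofReal _), mul_assoc,
          ENNReal.inv_mul_cancel (mul_ne_zero hd0 hball0)
            (ENNReal.mul_ne_top (ENNReal.natCast_ne_top d) hballt), mul_one]

/-- Gaussian tail of the coordinates of a uniform point of the sphere. -/
theorem uniformSphere_cap_le_exp {d : ℕ} (hd : 1 ≤ d) (x : EuclideanSpace ℝ (Fin d))
    (hx : ‖x‖ = 1) {t : ℝ} (ht0 : 0 ≤ t) :
    uniformSphere d {θ | t ≤ inner ℝ x (θ : EuclideanSpace ℝ (Fin d))} ≤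
      ENNReal.ofReal (Real.exp (-(d / 4 * t ^ 2))) := by
  rcases lt_or_ge 1 t with h1 | h1
  · have : {θ : UnitSphere d | t ≤ inner ℝ x (θ : EuclideanSpace ℝ (Fin d))} = ∅ := by
      ext θ
      simp only [Set.mem_ofPred_eq, Set.mem_empty_iff_false, iff_false, not_le]
      have hθ1 : ‖(θ : EuclideanSpace ℝ (Fin d))‖ = 1 := by simp
      have := real_inner_le_norm x (θ : EuclideanSpace ℝ (Fin d))
      rw [hx, hθ1] at this
      linarith
    simp [this]
  -- Lowering the height to `t / √2` meets the restriction `2 s² ≤ 1` for every `t ≤ 1`, at the cost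
  -- of half the exponent.
  · have h2 : Real.sqrt 2 ^ 2 = 2 := Real.sq_sqrt (by norm_num)
    have h3 : 1 ≤ Real.sqrt 2 := by rw [Real.one_le_sqrt]; norm_num
    have hsq : (t / Real.sqrt 2) ^ 2 = t ^ 2 / 2 := by rw [div_pow, h2]
    refine (measure_mono ?_).trans ((uniformSphere_cap_le_sqrt_pow hd x hx
      (s := t / Real.sqrt 2) (by positivity) ?_).trans (ENNReal.ofReal_le_ofReal ?_))
    · intro θ hθ
      exact (div_le_self ht0 h3).trans hθ
    · rw [hsq]; nlinarith
    · rw [hsq]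
      have h4 : Real.sqrt (1 - t ^ 2 / 2) ≤ Real.exp (-(t ^ 2 / 4)) := by
        apply Real.sqrt_le_iff.2 ⟨(Real.exp_pos _).le, ?_⟩
        rw [← Real.exp_nat_mul]
        have := Real.add_one_le_exp (-(t ^ 2 / 2))
        refine le_trans (by linarith) (this.trans_eq ?_)
        congr 1; push_cast; ring
      calc _ ≤ Real.exp (-(t ^ 2 / 4)) ^ d := by gcongr
        _ = _ := by
          rw [← Real.exp_nat_mul]; congr 1; ring

theorem uniformSphere_sq_inner_le {d : ℕ} (hd : 1 ≤ d) (x : EuclideanSpace ℝ (Fin d))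
    (hx : ‖x‖ = 1) {t : ℝ} (ht0 : 0 ≤ t) :
    uniformSphere d {θ | t ≤ (inner ℝ x (θ : EuclideanSpace ℝ (Fin d))) ^ 2} ≤
      ENNReal.ofReal (2 * Real.exp (-(d / 4 * t))) := by
  have hsub : {θ : UnitSphere d | t ≤ (inner ℝ x (θ : EuclideanSpace ℝ (Fin d))) ^ 2} ⊆
      {θ | Real.sqrt t ≤ inner ℝ x (θ : EuclideanSpace ℝ (Fin d))} ∪
      {θ | Real.sqrt t ≤ inner ℝ (-x) (θ : EuclideanSpace ℝ (Fin d))} := by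
    intro θ hθ
    have := Real.abs_le_sqrt (x := Real.sqrt t) (y := (inner ℝ x (θ : EuclideanSpace ℝ (Fin d)))^2)
      (by rw [Real.sq_sqrt ht0]; exact hθ)
    rw [Real.sqrt_sq_eq_abs, abs_of_nonneg (Real.sqrt_nonneg _), le_abs] at this
    simpa [inner_neg_left] using this
  refine (measure_mono hsub).trans ((measure_union_le _ _).trans ?_)
  have h1 := uniformSphere_cap_le_exp hd x hx (Real.sqrt_nonneg t)
  have h2 := uniformSphere_cap_le_exp hd (-x) (by simpa using hx) (Real.sqrt_nonneg t)
  rw [Real.sq_sqrt ht0] at h1 h2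
  refine (add_le_add h1 h2).trans_eq ?_
  rw [← ENNReal.ofReal_add (Real.exp_pos _).le (Real.exp_pos _).le, two_mul]

theorem continuous_inner_sphere {d : ℕ} (x : EuclideanSpace ℝ (Fin d)) :
    Continuous fun θ : UnitSphere d => (inner ℝ x (θ : EuclideanSpace ℝ (Fin d)) : ℝ) := by
  fun_prop

/-- Layer-cake formula: the rate `b = d/8` is half the tail rate `d/4`, so the integral is at most
`1 + ∫ 2 b exp (-b t) = 3`. -/
theorem integral_exp_mul_sq_inner_le {d : ℕ} (hd : 1 ≤ d) (x : EuclideanSpace ℝ (Fin d))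
    (hx : ‖x‖ = 1) :
    ∫ θ, Real.exp (d / 8 * (inner ℝ x (θ : EuclideanSpace ℝ (Fin d))) ^ 2) ∂(uniformSphere d)
      ≤ 3 := by
  have := isProbabilityMeasure_uniformSphere d hd
  have hc := continuous_inner_sphere x
  set X : UnitSphere d → ℝ := fun θ => inner ℝ x (θ : EuclideanSpace ℝ (Fin d)) with hX
  have hd0 : (0 : ℝ) < d := by exact_mod_cast hd
  set b : ℝ := d / 8 with hb
  have hb0 : 0 < b := by positivity
  have hprim (t : ℝ) : ∫ s in (0 : ℝ)..t, b * Real.exp (b * s) = Real.exp (b * t) - 1 := by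
    rw [intervalIntegral.integral_eq_sub_of_hasDerivAt (f := fun s => Real.exp (b * s))]
    · simp
    · intro s _
      have := ((hasDerivAt_id s).const_mul b).exp
      simpa [mul_comm] using this
    · exact (by fun_prop : Continuous fun s => b * Real.exp (b * s)).intervalIntegrable _ _
  have key := lintegral_comp_eq_lintegral_meas_le_mul (uniformSphere d) (f := fun θ => X θ ^ 2)
    (g := fun s => b * Real.exp (b * s)) (Filter.Eventually.of_forall fun _ => sq_nonneg _)
    (hc.pow 2).measurable.aemeasurable
    (fun t _ => (by fun_prop : Continuous fun s => b * Real.exp (b * s)).intervalIntegrable _ _)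
    (Filter.Eventually.of_forall fun _ => by positivity)
  simp only [hprim] at key
  have hbound : ∫⁻ t in Set.Ioi (0 : ℝ), uniformSphere d {a | t ≤ X a ^ 2} *
      ENNReal.ofReal (b * Real.exp (b * t)) ≤ ENNReal.ofReal 2 := by
    calc _ ≤ ∫⁻ t in Set.Ioi (0 : ℝ), ENNReal.ofReal (2 * b * Real.exp ((-b) * t)) := by
          refine setLIntegral_mono' measurableSet_Ioi fun t ht => ?_
          refine (mul_le_mul_left (uniformSphere_sq_inner_le hd x hx (le_of_lt ht)) _).trans_eq ?_
          rw [← ENNReal.ofReal_mul (by positivity)]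
          congr 1
          rw [show 2 * Real.exp (-(d / 4 * t)) * (b * Real.exp (b * t)) =
            2 * b * (Real.exp (-(d / 4 * t)) * Real.exp (b * t)) by ring, ← Real.exp_add]
          congr 2; rw [hb]; ring
      _ = ENNReal.ofReal (∫ t in Set.Ioi (0 : ℝ), 2 * b * Real.exp ((-b) * t)) := by
          rw [ofReal_integral_eq_lintegral_ofReal]
          · exact (integrableOn_exp_mul_Ioi (by linarith) 0).const_mul _
          · exact Filter.Eventually.of_forall fun _ => by positivity
      _ = _ := by
          rw [integral_const_mul, integral_exp_mul_Ioi (by linarith)]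
          congr 1; simp; field_simp
  rw [← key] at hbound
  have hint : Integrable (fun θ => Real.exp (b * X θ ^ 2) - 1) (uniformSphere d) :=
    (by fun_prop : Continuous fun θ => Real.exp (b * X θ ^ 2) - 1).integrable_of_hasCompactSupport
      (HasCompactSupport.of_compactSpace _)
  rw [← ofReal_integral_eq_lintegral_ofReal hint (Filter.Eventually.of_forall fun θ => by
    simp only [Pi.zero_apply, sub_nonneg, Real.one_le_exp_iff]; positivity),
    ENNReal.ofReal_le_ofReal_iff (by norm_num), integral_sub ?_ (integrable_const _)] at hbound
  · simp at hbound
    linarith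
  · exact (by fun_prop : Continuous fun θ => Real.exp (b * X θ ^ 2)).integrable_of_hasCompactSupport
      (HasCompactSupport.of_compactSpace _)

-- Supplies the symmetry that replaces `exp` by `cosh` in the moment generating function. Negation
-- exchanges the cones over a set and its antipode and preserves Lebesgue measure.
open scoped Pointwise in
theorem measurePreserving_neg_uniformSphere (d : ℕ) :
    MeasurePreserving (fun θ : UnitSphere d => -θ) (uniformSphere d) (uniformSphere d) := by
  have hm : Measurable (fun θ : UnitSphere d => -θ) := continuous_neg.measurable
  refine ⟨hm, ?_⟩
  rw [uniformSphere, Measure.map_smul]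
  congr 1
  ext s hs
  rw [Measure.map_apply hm hs, Measure.toSphere_apply' _ hs, Measure.toSphere_apply' _ (hm hs)]
  congr 1
  rw [← Measure.measure_neg]
  congr 1
  ext z
  simp only [Set.mem_neg, Set.mem_smul, Set.mem_image, Set.mem_preimage]
  constructor
  · rintro ⟨r, hr, _, ⟨θ, hθ, rfl⟩, h⟩
    exact ⟨r, hr, _, ⟨-θ, hθ, rfl⟩, by rw [← neg_inj, ← h]; simp⟩
  · rintro ⟨r, hr, _, ⟨θ, hθ, rfl⟩, h⟩
    exact ⟨r, hr, _, ⟨-θ, by simpa using hθ, rfl⟩, by rw [← h]; simp⟩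

/-- For `4 s² ≤ d`, symmetry kills the linear term, and `cosh y ≤ exp (y²/2)` with convexity of
`exp` between `0` and `d/8 * X²` gives `1 + 8 s²/d`. For larger `s`, completing the square gives `3
exp (2 s²/d)`, and the factor `3` is absorbed since `6 s²/d > 3/2`. -/
theorem mgf_inner_uniformSphere_le {d : ℕ} (hd : 1 ≤ d) (x : EuclideanSpace ℝ (Fin d))
    (hx : ‖x‖ = 1) (s : ℝ) :
    ∫ θ, Real.exp (s * inner ℝ x (θ : EuclideanSpace ℝ (Fin d))) ∂(uniformSphere d)
      ≤ Real.exp (8 * s ^ 2 / d) := by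
  have := isProbabilityMeasure_uniformSphere d hd
  have hc := continuous_inner_sphere x
  set X : UnitSphere d → ℝ := fun θ => inner ℝ x (θ : EuclideanSpace ℝ (Fin d)) with hX
  have hint {f : UnitSphere d → ℝ} (hf : Continuous f) : Integrable f (uniformSphere d) :=
    hf.integrable_of_hasCompactSupport (HasCompactSupport.of_compactSpace _)
  have hd0 : (0 : ℝ) < d := by exact_mod_cast hd
  have h3 : ∫ θ, Real.exp (d / 8 * X θ ^ 2) ∂(uniformSphere d) ≤ 3 :=
    integral_exp_mul_sq_inner_le hd x hx
  rcases le_or_gt (4 * s ^ 2) (d : ℝ) with hs | hs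
  · have hsym : ∫ θ, Real.exp (-(s * X θ)) ∂(uniformSphere d) =
        ∫ θ, Real.exp (s * X θ) ∂(uniformSphere d) := by
      rw [← (measurePreserving_neg_uniformSphere d).integral_comp
        (Homeomorph.neg (UnitSphere d)).measurableEmbedding]
      simp [hX]
    have hcosh : ∫ θ, Real.exp (s * X θ) ∂(uniformSphere d) =
        ∫ θ, Real.cosh (s * X θ) ∂(uniformSphere d) := by
      simp_rw [Real.cosh_eq]
      rw [integral_div, integral_add (hint (by fun_prop)) (hint (by fun_prop)), hsym]
      ring
    have hpt (θ : UnitSphere d) : Real.cosh (s * X θ) ≤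
        1 + 4 * s ^ 2 / d * (Real.exp (d / 8 * X θ ^ 2) - 1) := by
      refine (Real.cosh_le_exp_half_sq _).trans ?_
      have hconv := (convexOn_exp).2 (Set.mem_univ 0) (Set.mem_univ (d / 8 * X θ ^ 2))
        (show (0 : ℝ) ≤ 1 - 4 * s ^ 2 / d
          by rw [sub_nonneg, div_le_one hd0]; exact hs)
        (show (0 : ℝ) ≤ 4 * s ^ 2 / d by positivity) (by ring)
      simp only [smul_eq_mul, mul_zero, zero_add, Real.exp_zero, mul_one] at hconv
      have e1 : (s * X θ) ^ 2 / 2 = 4 * s ^ 2 / d * (d / 8 * X θ ^ 2) := by field_simp; ring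
      rw [e1]; linarith
    rw [hcosh]
    calc _ ≤ ∫ θ, (1 + 4 * s ^ 2 / d * (Real.exp (d / 8 * X θ ^ 2) - 1)) ∂(uniformSphere d) :=
          integral_mono (hint (by fun_prop)) (hint (by fun_prop)) hpt
      _ = 1 + 4 * s ^ 2 / d * (∫ θ, Real.exp (d / 8 * X θ ^ 2) ∂(uniformSphere d) - 1) := by
          rw [integral_add (integrable_const _) (hint (by fun_prop)), integral_const_mul,
            integral_sub (hint (by fun_prop)) (integrable_const _)]
          simp
      _ ≤ 1 + 4 * s ^ 2 / d * (3 - 1) := by gcongr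
      _ ≤ _ := by
          have := Real.add_one_le_exp (8 * s ^ 2 / d)
          refine le_trans (le_of_eq ?_) this
          ring
  · have hpt (θ : UnitSphere d) : Real.exp (s * X θ) ≤
        Real.exp (2 * s ^ 2 / d) * Real.exp (d / 8 * X θ ^ 2) := by
      rw [← Real.exp_add]
      apply Real.exp_le_exp.2
      have : 2 * s ^ 2 / d + d / 8 * X θ ^ 2 - s * X θ = (4 * s - d * X θ) ^ 2 / (8 * d) := by
        field_simp; ring
      have h2 : 0 ≤ (4 * s - d * X θ) ^ 2 / (8 * d) := by positivity
      linarith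
    calc _ ≤ ∫ θ, Real.exp (2 * s ^ 2 / d) * Real.exp (d / 8 * X θ ^ 2) ∂(uniformSphere d) :=
          integral_mono (hint (by fun_prop)) (hint (by fun_prop)) hpt
      _ ≤ Real.exp (2 * s ^ 2 / d) * 3 := by rw [integral_const_mul]; gcongr
      _ ≤ Real.exp (2 * s ^ 2 / d) * Real.exp (6 * s ^ 2 / d) := by
          gcongr
          have h1 : 1 < 4 * s ^ 2 / d := by rwa [one_lt_div hd0]
          have h2 : 6 * s ^ 2 / d = 3 / 2 * (4 * s ^ 2 / d) := by ring
          have h4 := Real.quadratic_le_exp_of_nonneg (x := 3 / 2) (by norm_num)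
          have h5 : Real.exp (3 / 2) ≤ Real.exp (6 * s ^ 2 / d) := by
            apply Real.exp_le_exp.2; rw [h2]; linarith
          have h6 := Real.exp_one_gt_d9
          have h7 : Real.exp (3 / 2) = Real.exp 1 * Real.exp (1 / 2) := by
            rw [← Real.exp_add]; norm_num
          have h8 := Real.add_one_le_exp (1 / 2 : ℝ)
          nlinarith
      _ = _ := by rw [← Real.exp_add]; congr 1; ring

theorem hasSubgaussianMGF_inner_uniformSphere {d : ℕ} (hd : 1 ≤ d)
    (y : EuclideanSpace ℝ (Fin d)) :
    HasSubgaussianMGF (fun θ : UnitSphere d => (inner ℝ y (θ : EuclideanSpace ℝ (Fin d)) : ℝ))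
      (16 / d * ‖y‖₊ ^ 2) (uniformSphere d) := by
  have := isProbabilityMeasure_uniformSphere d hd
  refine ⟨fun t => (by fun_prop : Continuous fun θ : UnitSphere d => Real.exp (t *
    inner ℝ y (θ : EuclideanSpace ℝ (Fin d)))).integrable_of_hasCompactSupport
      (HasCompactSupport.of_compactSpace _), fun t => ?_⟩
  rw [mgf]
  rcases eq_or_ne y 0 with rfl | hy
  · simp
  · have hn : ‖y‖ ≠ 0 := norm_ne_zero_iff.2 hy
    have h := mgf_inner_uniformSphere_le hd (‖y‖⁻¹ • y) (by simp [norm_smul, hn]) (t * ‖y‖)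
    simp only [real_inner_smul_left] at h
    convert h using 2
    · ext θ; field_simp
    · push_cast; ring

/-! ### Moment calculus with explicit real bounds -/

section Moments

variable {Ω : Type*} [MeasurableSpace Ω] {μ : Measure Ω}

theorem eLpNorm_natCast_le_iff {E : Type*} [NormedAddCommGroup E] {p : ℕ} (hp : 1 ≤ p) (f : Ω → E)
    (K : ENNReal) :
    eLpNorm f p μ ≤ K ↔ ∫⁻ ω, ‖f ω‖ₑ ^ p ∂μ ≤ K ^ p := by
  have hp0 : (0 : ℝ) < p := by exact_mod_cast hp
  rw [eLpNorm_eq_lintegral_rpow_enorm_toReal (by simp; omega) (by simp)]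
  simp only [ENNReal.toReal_natCast, ENNReal.rpow_natCast, one_div]
  rw [ENNReal.rpow_inv_le_iff hp0, ENNReal.rpow_natCast]

theorem eLpNorm_sum_le_ofReal {ι : Type*} {s : Finset ι} {f : ι → Ω → ℝ} {K : ι → ℝ} {p : ℕ}
    (hp : 1 ≤ p) (hf : ∀ i ∈ s, AEStronglyMeasurable (f i) μ) (hK : ∀ i ∈ s, 0 ≤ K i)
    (h : ∀ i ∈ s, eLpNorm (f i) p μ ≤ ENNReal.ofReal (K i)) :
    eLpNorm (fun ω => ∑ i ∈ s, f i ω) p μ ≤ ENNReal.ofReal (∑ i ∈ s, K i) := by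
  rw [ENNReal.ofReal_sum_of_nonneg hK]
  have := eLpNorm_sum_le hf (p := p) (by exact_mod_cast hp)
  have e : (fun ω => ∑ i ∈ s, f i ω) = ∑ i ∈ s, f i := by ext; simp
  rw [e]
  exact this.trans (Finset.sum_le_sum h)

theorem eLpNorm_add_le_ofReal {f g : Ω → ℝ} {a b : ℝ} {p : ℕ}
    (hp : 1 ≤ p) (hf : AEStronglyMeasurable f μ) (hg : AEStronglyMeasurable g μ)
    (ha : 0 ≤ a) (hb : 0 ≤ b) (h : eLpNorm f p μ ≤ ENNReal.ofReal a)
    (h' : eLpNorm g p μ ≤ ENNReal.ofReal b) :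
    eLpNorm (fun ω => f ω + g ω) p μ ≤ ENNReal.ofReal (a + b) := by
  rw [ENNReal.ofReal_add ha hb]
  exact (eLpNorm_add_le hf hg (by exact_mod_cast hp)).trans (add_le_add h h')

theorem eLpNorm_const_mul_le_ofReal {f : Ω → ℝ} {a : ℝ} {p : ℕ} (c : ℝ)
    (h : eLpNorm f p μ ≤ ENNReal.ofReal a) :
    eLpNorm (fun ω => c * f ω) p μ ≤ ENNReal.ofReal (|c| * a) := by
  have := eLpNorm_const_smul c f p μ
  rw [ENNReal.ofReal_mul (abs_nonneg _)]
  refine this.trans_le ?_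
  rw [Real.enorm_eq_ofReal_abs]
  gcongr

theorem eLpNorm_const_le_ofReal [IsProbabilityMeasure μ] {a : ℝ} (ha : 0 ≤ a) {p : ℕ}
    (hp : 1 ≤ p) : eLpNorm (fun _ : Ω => a) p μ ≤ ENNReal.ofReal a := by
  rw [eLpNorm_const _ (by simp; omega) (NeZero.ne μ)]
  simp [Real.enorm_eq_ofReal ha]

theorem eLpNorm_sq_le_ofReal {f : Ω → ℝ} {a : ℝ} (ha : 0 ≤ a) {p : ℕ} (hp : 1 ≤ p)
    (h : eLpNorm f (2 * p : ℕ) μ ≤ ENNReal.ofReal a) :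
    eLpNorm (fun ω => f ω ^ 2) p μ ≤ ENNReal.ofReal (a ^ 2) := by
  rw [eLpNorm_natCast_le_iff (by omega)] at h ⊢
  simpa only [enorm_pow, ← pow_mul, ENNReal.ofReal_pow ha] using h

/-- Moment growth of a sub-Gaussian random variable. -/
theorem eLpNorm_le_of_hasSubgaussianMGF {X : Ω → ℝ} {c : NNReal}
    (h : HasSubgaussianMGF X c μ) {p : ℕ} (hp : 1 ≤ p) :
    eLpNorm X p μ ≤ ENNReal.ofReal (4 * Real.sqrt (p * c)) := by
  have hp0 : (0 : ℝ) < p := by exact_mod_cast hp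
  rcases eq_or_ne c 0 with rfl | hc
  · rw [eLpNorm_congr_ae (HasSubgaussianMGF.ae_eq_zero_of_hasSubgaussianMGF_zero h)]
    simp
  have hc0 : (0 : ℝ) < c := by exact_mod_cast pos_iff_ne_zero.2 hc
  rw [eLpNorm_natCast_le_iff hp, ← ENNReal.ofReal_pow (by positivity)]
  set r : ℝ := Real.sqrt (p * c) with hr
  have hr0 : 0 < r := by positivity
  have hr2 : r ^ 2 = p * c := Real.sq_sqrt (by positivity)
  -- This choice turns `r ^ p * exp (t |x|)` into a bound for `|x| ^ p` and makes the sub-Gaussian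
  -- exponent `c t²/2` equal to `p/2`.
  set t : ℝ := p / r with ht
  have hpt (x : ℝ) : |x| ^ p ≤ r ^ p * (Real.exp (t * x) + Real.exp (-t * x)) := by
    have h1 : |x| ^ p ≤ r ^ p * Real.exp (t * |x|) := by
      have h2 : |x| / r ≤ Real.exp (|x| / r) := by
        linarith [Real.add_one_le_exp (|x| / r)]
      calc |x| ^ p = r ^ p * (|x| / r) ^ p := by rw [← mul_pow]; congr 1; field_simp
        _ ≤ r ^ p * Real.exp (|x| / r) ^ p := by gcongr
        _ = _ := by rw [← Real.exp_nat_mul]; congr 2; rw [ht]; ring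
    refine h1.trans ?_
    gcongr
    rcases abs_cases x with ⟨e, _⟩ | ⟨e, _⟩ <;> rw [e]
    · linarith [Real.exp_pos (-t * x)]
    · rw [mul_neg, neg_mul]; linarith [Real.exp_pos (t * x)]
  have hi1 := h.integrable_exp_mul t
  have hi2 := h.integrable_exp_mul (-t)
  have hm1 := h.mgf_le t
  have hm2 := h.mgf_le (-t)
  have hte : c * t ^ 2 / 2 = p * (1 / 2 : ℝ) := by
    rw [ht, div_pow, hr2]; field_simp
  rw [neg_sq, hte] at hm2
  rw [hte] at hm1
  calc ∫⁻ ω, ‖X ω‖ₑ ^ p ∂μ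
      ≤ ∫⁻ ω, ENNReal.ofReal (r ^ p * (Real.exp (t * X ω) + Real.exp (-t * X ω))) ∂μ := by
        refine lintegral_mono fun ω => ?_
        simp only
        rw [Real.enorm_eq_ofReal_abs, ← ENNReal.ofReal_pow (abs_nonneg _)]
        exact ENNReal.ofReal_le_ofReal (hpt _)
    _ = ENNReal.ofReal (r ^ p * (mgf X μ t + mgf X μ (-t))) := by
        have hi : Integrable (fun ω => r ^ p * (Real.exp (t * X ω) + Real.exp (-t * X ω))) μ :=
          (hi1.add hi2).const_mul _
        rw [← ofReal_integral_eq_lintegral_ofReal hi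
          (Filter.Eventually.of_forall fun ω => by positivity), integral_const_mul,
          integral_add hi1 hi2]
        rfl
    _ ≤ _ := by
        apply ENNReal.ofReal_le_ofReal
        rw [mul_comm 4 r, mul_pow]
        gcongr
        have h2 : Real.exp (1 / 2) ≤ 2 := by
          have h3 : Real.exp 1 = Real.exp (1 / 2) ^ 2 := by
            rw [← Real.exp_nat_mul]; norm_num
          have h4 := Real.exp_one_lt_d9
          nlinarith [Real.exp_pos (1 / 2)]
        calc _ ≤ 2 * Real.exp (1 / 2) ^ p := by rw [← Real.exp_nat_mul]; linarith
          _ ≤ 2 ^ p * 2 ^ p := by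
            gcongr
            exact le_self_pow₀ (by norm_num) (by omega)
          _ = 4 ^ p := by rw [← mul_pow]; norm_num

end Moments

/-! ### Conditioning on a block of coordinates -/

section Blocks

variable {V : Type*} [Fintype V] {X : Type*} [MeasurableSpace X]

open Classical in
/-- In a product space the blocks of coordinates in `S` and outside `S` are independent. -/
theorem measurePreserving_piecewise (ν : Measure X) [IsProbabilityMeasure ν] (S : Finset V) :
    MeasurePreserving (fun q : (V → X) × (V → X) => S.piecewise q.1 q.2)
      ((Measure.pi fun _ => ν).prod (Measure.pi fun _ => ν)) (Measure.pi fun _ => ν) := by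
  have hm : Measurable (fun q : (V → X) × (V → X) => S.piecewise q.1 q.2) := by
    refine measurable_pi_iff.2 fun v => ?_
    by_cases hv : v ∈ S <;> simp only [Finset.piecewise, hv, if_true, if_false] <;> fun_prop
  refine ⟨hm, ?_⟩
  refine (Measure.pi_eq fun s hs => ?_).symm
  rw [Measure.map_apply hm (MeasurableSet.univ_pi hs)]
  have : (fun q : (V → X) × (V → X) => S.piecewise q.1 q.2) ⁻¹' Set.univ.pi s =
      (Set.univ.pi fun v => if v ∈ S then s v else Set.univ) ×ˢ
        (Set.univ.pi fun v => if v ∈ S then Set.univ else s v) := by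
    ext q
    simp only [Set.mem_preimage, Set.mem_pi, Set.mem_univ, true_imp_iff, Set.mem_prod,
      ← forall_and]
    refine forall_congr' fun v => ?_
    by_cases hv : v ∈ S <;> simp [hv]
  rw [this, Measure.prod_prod, Measure.pi_pi, Measure.pi_pi, ← Finset.prod_mul_distrib]
  refine Finset.prod_congr rfl fun v _ => ?_
  by_cases hv : v ∈ S <;> simp [hv]

open Classical in
/-- Conditioning an `L^p` estimate on the coordinates outside `S`. -/
theorem eLpNorm_le_of_piecewise (ν : Measure X) [IsProbabilityMeasure ν] (S : Finset V)
    {F g : (V → X) → ℝ} (hF : Measurable F) (hg : ∀ ω, 0 ≤ g ω) {p : ℕ} (hp : 1 ≤ p) {K : ℝ}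
    (h : ∀ ω', eLpNorm (fun ω => F (S.piecewise ω ω')) p (Measure.pi fun _ => ν) ≤
      ENNReal.ofReal (g ω'))
    (hgK : eLpNorm g p (Measure.pi fun _ => ν) ≤ ENNReal.ofReal K) :
    eLpNorm F p (Measure.pi fun _ => ν) ≤ ENNReal.ofReal K := by
  rw [eLpNorm_natCast_le_iff hp] at hgK ⊢
  refine le_trans ?_ hgK
  have hmp := measurePreserving_piecewise ν S
  have hF' : Measurable fun ω => ‖F ω‖ₑ ^ p := hF.enorm.pow_const p
  rw [← hmp.lintegral_comp hF', lintegral_prod_symm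
    (fun q : (V → X) × (V → X) => ‖F (S.piecewise q.1 q.2)‖ₑ ^ p)
    (hF'.comp hmp.measurable).aemeasurable]
  refine lintegral_mono fun ω' => ?_
  have := (eLpNorm_natCast_le_iff hp _ _).1 (h ω')
  simpa only [Real.enorm_eq_ofReal (hg ω')] using this

end Blocks

/-! ### Counting separating subsets -/

section Averaging

variable {V : Type*} [Fintype V]

-- A uniformly random `S` contains `A` and misses `B` with probability `2 ^ -(|A| + |B|)`: the
-- admissible `S` form the interval from `A` to the complement of `B`.
open Classical in
theorem sum_finset_separating (A B : Finset V) (hAB : Disjoint A B) :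
    (2 : ℝ) ^ (A.card + B.card) *
      ∑ S : Finset V, (if A ⊆ S ∧ Disjoint S B then (1 : ℝ) else 0) =
      2 ^ Fintype.card V := by
  have h1 : (Finset.univ.filter fun S : Finset V => A ⊆ S ∧ Disjoint S B) = Finset.Icc A Bᶜ := by
    ext S
    simp [Finset.mem_Icc, Finset.subset_compl_iff_disjoint_right]
  have h2 : A ⊆ Bᶜ := Finset.subset_compl_iff_disjoint_right.2 hAB
  rw [Finset.sum_boole, h1, Finset.card_Icc_finset h2]
  push_cast
  rw [← pow_add, Finset.card_compl]
  congr 1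
  have := Finset.card_le_card h2
  rw [Finset.card_compl] at this
  have := Finset.card_le_univ B
  omega

end Averaging

/-! ### Quadratic chaos in the random points -/

section Chaos

variable {V : Type*} {d : ℕ}

/-- The Gram matrix of the points `p v`. -/
noncomputable def gram (p : V → UnitSphere d) (v w : V) : ℝ :=
  inner ℝ (p v : EuclideanSpace ℝ (Fin d)) (p w : EuclideanSpace ℝ (Fin d))

@[fun_prop]
theorem continuous_gram (v w : V) : Continuous fun p : V → UnitSphere d => gram p v w := by
  unfold gram; fun_prop

theorem gram_self (p : V → UnitSphere d) (v : V) : gram p v v = 1 := by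
  simp [gram]

theorem gram_comm (p : V → UnitSphere d) (v w : V) : gram p v w = gram p w v :=
  real_inner_comm _ _

variable [Fintype V]

instance instIsProbabilityMeasureUniformSphere [NeZero d] :
    IsProbabilityMeasure (uniformSphere d) :=
  isProbabilityMeasure_uniformSphere d (NeZero.one_le)

/-- The joint law of independent uniform points of the sphere indexed by `V`. -/
noncomputable abbrev codeLaw (V : Type*) [Fintype V] (d : ℕ) : Measure (V → UnitSphere d) :=
  Measure.pi fun _ => uniformSphere d

/-- The linear combination of the points `p v` with coefficients `u v`. -/
noncomputable def combo (u : V → ℝ) (p : V → UnitSphere d) : EuclideanSpace ℝ (Fin d) :=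
  ∑ v, u v • (p v : EuclideanSpace ℝ (Fin d))

/-- The deviation of the squared norm of a combination from its mean. -/
noncomputable def chaos (u : V → ℝ) (p : V → UnitSphere d) : ℝ :=
  ‖combo u p‖ ^ 2 - ∑ v, u v ^ 2

@[fun_prop]
theorem continuous_combo (u : V → ℝ) : Continuous (combo (d := d) u) := by
  unfold combo; fun_prop

@[fun_prop]
theorem continuous_chaos (u : V → ℝ) : Continuous (chaos (d := d) u) := by
  unfold chaos; fun_prop

theorem inner_combo_combo (u u' : V → ℝ) (p : V → UnitSphere d) :
    inner ℝ (combo u p) (combo u' p) = ∑ v, ∑ w, u v * u' w * gram p v w := by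
  rw [combo, combo, sum_inner]
  refine Finset.sum_congr rfl fun v _ => ?_
  rw [inner_sum]
  refine Finset.sum_congr rfl fun w _ => ?_
  rw [real_inner_smul_left, real_inner_smul_right, gram]
  ring

theorem norm_combo_sq (u : V → ℝ) (p : V → UnitSphere d) :
    ‖combo u p‖ ^ 2 = ∑ v, ∑ w, u v * u w * gram p v w := by
  rw [← real_inner_self_eq_norm_sq, inner_combo_combo]

open Classical in
theorem chaos_eq_sum (u : V → ℝ) (p : V → UnitSphere d) :
    chaos u p = ∑ v, ∑ w, if v ≠ w then u v * u w * gram p v w else 0 := by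
  rw [chaos, norm_combo_sq, ← Finset.sum_sub_distrib]
  refine Finset.sum_congr rfl fun v _ => ?_
  rw [sub_eq_iff_eq_add]
  have : u v ^ 2 = ∑ w, if v = w then u v * u w * gram p v w else 0 := by
    simp [gram_self, sq]
  rw [this, ← Finset.sum_add_distrib]
  refine Finset.sum_congr rfl fun w _ => ?_
  by_cases h : v = w <;> simp [h]

open Classical in
theorem combo_indicator_piecewise (S : Finset V) (u : V → ℝ) (ω ω' : V → UnitSphere d) :
    combo ((S : Set V).indicator u) (S.piecewise ω ω') = combo ((S : Set V).indicator u) ω := by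
  unfold combo
  refine Finset.sum_congr rfl fun v _ => ?_
  by_cases h : v ∈ S <;> simp [h]

open Classical in
theorem combo_indicator_compl_piecewise (S : Finset V) (u : V → ℝ) (ω ω' : V → UnitSphere d) :
    combo ((S : Set V)ᶜ.indicator u) (S.piecewise ω ω') =
      combo ((S : Set V)ᶜ.indicator u) ω' := by
  unfold combo
  refine Finset.sum_congr rfl fun v _ => ?_
  by_cases h : v ∈ S <;> simp [h]

theorem sum_indicator_sq_le (S : Set V) (u : V → ℝ) :
    ∑ v, S.indicator u v ^ 2 ≤ ∑ v, u v ^ 2 := by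
  classical
  refine Finset.sum_le_sum fun v _ => ?_
  by_cases h : v ∈ S <;> simp [h, sq_nonneg]

/-- Decoupling of the second order chaos. -/
theorem two_pow_mul_chaos (u : V → ℝ) (p : V → UnitSphere d) :
    (2 : ℝ) ^ Fintype.card V * chaos u p = ∑ S : Finset V,
      4 * inner ℝ (combo ((S : Set V)ᶜ.indicator u) p) (combo ((S : Set V).indicator u) p) := by
  classical
  simp only [inner_combo_combo, Finset.mul_sum, chaos_eq_sum]
  symm
  rw [Finset.sum_comm]
  refine Finset.sum_congr rfl fun v _ => ?_
  rw [Finset.sum_comm]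
  refine Finset.sum_congr rfl fun w _ => ?_
  by_cases h : v = w
  · subst h
    simp only [ne_eq, not_true_eq_false, if_false, mul_zero]
    refine Finset.sum_eq_zero fun S _ => ?_
    by_cases hv : v ∈ S <;> simp [hv]
  -- A quarter of all subsets contain `w` and miss `v`; this is the source of the factor `4`.
  · have := sum_finset_separating {w} {v} (by simpa using Ne.symm h)
    simp only [Finset.card_singleton, Finset.singleton_subset_iff,
      Finset.disjoint_singleton_right] at this
    rw [if_pos h, ← this, Finset.mul_sum, Finset.sum_mul]
    refine Finset.sum_congr rfl fun S _ => ?_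
    by_cases hv : v ∈ S <;> by_cases hw : w ∈ S <;> simp [hv, hw]
    norm_num

theorem aestronglyMeasurable_of_continuous {f : (V → UnitSphere d) → ℝ} (hf : Continuous f) :
    AEStronglyMeasurable f (codeLaw V d) :=
  hf.measurable.aestronglyMeasurable

variable [NeZero d]

/-- By independence the variance proxies add up to `16/d * ‖y‖² * ∑ u²`, and the sub-Gaussian moment
bound contributes another factor `4`. -/
theorem eLpNorm_inner_combo_le (y : EuclideanSpace ℝ (Fin d)) (u : V → ℝ) {q : ℕ} (hq : 1 ≤ q) :
    eLpNorm (fun p => (inner ℝ y (combo u p) : ℝ)) q (codeLaw V d) ≤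
      ENNReal.ofReal (16 * Real.sqrt (q / d) * (‖y‖ * Real.sqrt (∑ v, u v ^ 2))) := by
  have hd : 1 ≤ d := NeZero.one_le
  have hind : iIndepFun (fun v (p : V → UnitSphere d) =>
      u v * inner ℝ y (p v : EuclideanSpace ℝ (Fin d))) (codeLaw V d) :=
    iIndepFun_pi (X := fun v (θ : UnitSphere d) =>
      u v * (inner ℝ y (θ : EuclideanSpace ℝ (Fin d)) : ℝ)) fun v =>
        (by fun_prop : Continuous fun θ : UnitSphere d =>
          u v * (inner ℝ y (θ : EuclideanSpace ℝ (Fin d)) : ℝ)).measurable.aemeasurable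
  have hsub (v : V) : HasSubgaussianMGF (fun p : V → UnitSphere d =>
      u v * inner ℝ y (p v : EuclideanSpace ℝ (Fin d)))
      (‖u v‖₊ ^ 2 * (16 / d * ‖y‖₊ ^ 2)) (codeLaw V d) := by
    have e : (‖u v‖₊ ^ 2 : NNReal) = NNReal.mk (u v ^ 2) (sq_nonneg _) :=
      NNReal.eq (by rw [NNReal.coe_pow, coe_nnnorm, Real.norm_eq_abs, sq_abs]; rfl)
    rw [e]
    refine HasSubgaussianMGF.const_mul ?_ (u v)
    have := hasSubgaussianMGF_inner_uniformSphere hd y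
    rw [← (measurePreserving_eval (fun _ : V => uniformSphere d) v).map_eq] at this
    exact this.of_map (Y := fun p : V → UnitSphere d => p v)
      (measurable_pi_apply v).aemeasurable
  have hsum := HasSubgaussianMGF.sum_of_iIndepFun hind (s := Finset.univ) fun v _ => hsub v
  have h := eLpNorm_le_of_hasSubgaussianMGF hsum hq
  have e : (fun p : V → UnitSphere d => (inner ℝ y (combo u p) : ℝ)) =
      fun p => ∑ v, u v * inner ℝ y (p v : EuclideanSpace ℝ (Fin d)) := by
    ext p; simp [combo, inner_sum, real_inner_smul_right]
  rw [e]
  refine h.trans_eq ?_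
  congr 1
  have e2 : (q : ℝ) * ((∑ v, (‖u v‖₊ ^ 2 * (16 / d * ‖y‖₊ ^ 2)) : NNReal) : ℝ) =
      4 ^ 2 * ((q / d) * (‖y‖ ^ 2 * ∑ v, u v ^ 2)) := by
    push_cast
    simp only [Real.norm_eq_abs, sq_abs]
    rw [← Finset.sum_mul]
    ring
  rw [e2, Real.sqrt_mul (by positivity), Real.sqrt_sq (by norm_num), Real.sqrt_mul (by positivity),
    Real.sqrt_mul (by positivity), Real.sqrt_sq (norm_nonneg _)]
  ring

/-- Given the points outside `S`, the inner product is linear in the points of `S`. The weighted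
AM-GM inequality with parameter `a` trades the norm of the outside combination for its square, and
`a` stays free so that the `m / a` term can be absorbed later. -/
theorem eLpNorm_decoupled_le (S : Finset V) (u : V → ℝ) {q : ℕ} (hq : 1 ≤ q) {m a : ℝ}
    (ha : 0 < a) (hm : 0 ≤ m)
    (h : eLpNorm (fun p => ‖combo ((S : Set V)ᶜ.indicator u) p‖ ^ 2) q (codeLaw V d) ≤
      ENNReal.ofReal m) :
    eLpNorm (fun p => (inner ℝ (combo ((S : Set V)ᶜ.indicator u) p)
      (combo ((S : Set V).indicator u) p) : ℝ)) q (codeLaw V d) ≤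
      ENNReal.ofReal (8 * Real.sqrt (q / d) * (a * ∑ v, u v ^ 2 + m / a)) := by
  classical
  set U := ∑ v, u v ^ 2 with hU
  have hU0 : 0 ≤ U := Finset.sum_nonneg fun _ _ => sq_nonneg _
  refine eLpNorm_le_of_piecewise (uniformSphere d) S (g := fun ω' => 8 * Real.sqrt (q / d) *
    (a * U + a⁻¹ * ‖combo ((S : Set V)ᶜ.indicator u) ω'‖ ^ 2))
    (by fun_prop : Continuous _).measurable (fun ω' => by positivity) hq (fun ω' => ?_) ?_
  · simp only [combo_indicator_piecewise, combo_indicator_compl_piecewise]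
    refine (eLpNorm_inner_combo_le _ _ hq).trans (ENNReal.ofReal_le_ofReal ?_)
    set n := ‖combo ((S : Set V)ᶜ.indicator u) ω'‖
    have h1 : Real.sqrt (∑ v, (S : Set V).indicator u v ^ 2) ≤ Real.sqrt U :=
      Real.sqrt_le_sqrt (sum_indicator_sq_le _ _)
    have h2 : n * Real.sqrt U ≤ (a * U + a⁻¹ * n ^ 2) / 2 := by
      have h3 : Real.sqrt U ^ 2 = U := Real.sq_sqrt hU0
      have h4 : a * U + a⁻¹ * n ^ 2 - 2 * (n * Real.sqrt U) =
          a⁻¹ * (a * Real.sqrt U - n) ^ 2 := by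
        rw [← h3]
        rw [Real.sqrt_sq (Real.sqrt_nonneg U)]
        field_simp
        ring
      have h5 : 0 ≤ a⁻¹ * (a * Real.sqrt U - n) ^ 2 := by positivity
      linarith
    calc _ ≤ 16 * Real.sqrt (q / d) * (n * Real.sqrt U) := by gcongr
      _ ≤ 16 * Real.sqrt (q / d) * ((a * U + a⁻¹ * n ^ 2) / 2) := by gcongr
      _ = _ := by ring
  · have h1 := eLpNorm_const_mul_le_ofReal a⁻¹ h
    have h2 := eLpNorm_add_le_ofReal hq aestronglyMeasurable_const
      (aestronglyMeasurable_of_continuous (by fun_prop)) (by positivity) (by positivity)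
      (eLpNorm_const_le_ofReal (μ := codeLaw V d) (mul_nonneg ha.le hU0) hq) h1
    have h3 := eLpNorm_const_mul_le_ofReal (8 * Real.sqrt (q / d)) h2
    refine h3.trans_eq ?_
    congr 1
    rw [abs_of_nonneg (by positivity), abs_of_nonneg (by positivity)]
    ring

theorem eLpNorm_chaos_le_of_forall (u : V → ℝ) {q : ℕ} (hq : 1 ≤ q) {m a : ℝ}
    (ha : 0 < a) (hm : 0 ≤ m)
    (h : ∀ S : Finset V, eLpNorm (fun p => ‖combo ((S : Set V).indicator u) p‖ ^ 2) q
      (codeLaw V d) ≤ ENNReal.ofReal m) :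
    eLpNorm (chaos u) q (codeLaw V d) ≤
      ENNReal.ofReal (32 * Real.sqrt (q / d) * (a * ∑ v, u v ^ 2 + m / a)) := by
  classical
  have hU0 : 0 ≤ ∑ v, u v ^ 2 := Finset.sum_nonneg fun _ _ => sq_nonneg _
  have h1 (S : Finset V) := eLpNorm_const_mul_le_ofReal 4 (eLpNorm_decoupled_le S u hq ha hm
    (by simpa using h Sᶜ))
  have h2 := eLpNorm_sum_le_ofReal (s := Finset.univ) hq
    (fun S _ => aestronglyMeasurable_of_continuous (by fun_prop))
    (fun S _ => by positivity) (fun S _ => h1 S)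
  have h3 := eLpNorm_const_mul_le_ofReal ((2 : ℝ) ^ Fintype.card V)⁻¹ h2
  have e : chaos u = fun p : V → UnitSphere d => ((2 : ℝ) ^ Fintype.card V)⁻¹ * ∑ S : Finset V,
      4 * inner ℝ (combo ((S : Set V)ᶜ.indicator u) p) (combo ((S : Set V).indicator u) p) := by
    ext p
    rw [← two_pow_mul_chaos, inv_mul_cancel_left₀ (by positivity)]
  rw [e]
  refine h3.trans_eq ?_
  congr 1
  rw [Finset.sum_const, Finset.card_univ, Fintype.card_finset, abs_of_nonneg (by positivity),
    nsmul_eq_mul, abs_of_nonneg (by norm_num)]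
  push_cast
  field_simp
  ring

/-- The moments up to order `d` of the squared norm of a combination are comparable to its mean. -/
theorem eLpNorm_norm_combo_sq_le (u : V → ℝ) {q : ℕ} (hq : 1 ≤ q) (hqd : q ≤ d) :
    eLpNorm (fun p => ‖combo u p‖ ^ 2) q (codeLaw V d) ≤
      ENNReal.ofReal (4098 * ∑ v, u v ^ 2) := by
  classical
  have hU0 : 0 ≤ ∑ v, u v ^ 2 := Finset.sum_nonneg fun _ _ => sq_nonneg _
  have hfin (S : Finset V) : eLpNorm (fun p => ‖combo ((S : Set V).indicator u) p‖ ^ 2) q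
      (codeLaw V d) ≠ ⊤ :=
    ((by fun_prop : Continuous fun p : V → UnitSphere d =>
      ‖combo ((S : Set V).indicator u) p‖ ^ 2).memLp_of_hasCompactSupport
        (HasCompactSupport.of_compactSpace _)).eLpNorm_ne_top
  set k : Finset V → ℝ := fun S => (eLpNorm (fun p => ‖combo ((S : Set V).indicator u) p‖ ^ 2) q
      (codeLaw V d)).toReal with hk
  -- Bootstrap: the bound for one restriction of `u` involves the moments of its further
  -- restrictions, so it is applied at the restriction with the largest moment. That moment is
  -- finite by compactness.
  obtain ⟨T, hT⟩ := Finite.exists_max k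
  have hsq : Real.sqrt (q / d) ≤ 1 := by
    rw [Real.sqrt_le_one]
    apply div_le_one_of_le₀ (by exact_mod_cast hqd) (by positivity)
  have hmax (S : Finset V) : eLpNorm (fun p => ‖combo ((S : Set V).indicator u) p‖ ^ 2) q
      (codeLaw V d) ≤ ENNReal.ofReal (k T) := by
    rw [← ENNReal.ofReal_toReal (hfin S)]
    exact ENNReal.ofReal_le_ofReal (hT S)
  have hk0 : 0 ≤ k T := ENNReal.toReal_nonneg
  have hUT := sum_indicator_sq_le (T : Set V) u
  have hUT0 : 0 ≤ ∑ v, (T : Set V).indicator u v ^ 2 := Finset.sum_nonneg fun _ _ => sq_nonneg _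
  -- With `a = 64` the maximum reappears with coefficient at most `32/64 = 1/2`, so `k T / 2 ≤ (32 *
  -- 64 + 1) U = 2049 U`, where `U` is the sum of the `u v ^ 2`.
  have h1 := eLpNorm_chaos_le_of_forall (d := d) ((T : Set V).indicator u) hq (a := 64)
    (by norm_num) hk0 (fun S => by
      rw [Set.indicator_indicator, ← Finset.coe_inter]; exact hmax _)
  have h2 := eLpNorm_add_le_ofReal hq (aestronglyMeasurable_of_continuous (by fun_prop))
    aestronglyMeasurable_const (by positivity) hUT0 h1
    (eLpNorm_const_le_ofReal (μ := codeLaw V d) hUT0 hq)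
  simp only [chaos, sub_add_cancel] at h2
  have h3 : k T ≤ 32 * Real.sqrt (q / d) *
      (64 * ∑ v, (T : Set V).indicator u v ^ 2 + k T / 64) +
      ∑ v, (T : Set V).indicator u v ^ 2 := ENNReal.toReal_le_of_le_ofReal (by positivity) h2
  have h4 : k T ≤ 4098 * ∑ v, u v ^ 2 := by
    have : 32 * Real.sqrt (q / d) * (64 * ∑ v, (T : Set V).indicator u v ^ 2 + k T / 64) ≤
      32 * 1 * (64 * ∑ v, u v ^ 2 + k T / 64) := by gcongr
    linarith
  have := hmax Finset.univ
  simp only [Finset.coe_univ, Set.indicator_univ] at this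
  exact this.trans (ENNReal.ofReal_le_ofReal h4)

theorem eLpNorm_chaos_le (u : V → ℝ) {q : ℕ} (hq : 1 ≤ q) (hqd : q ≤ d) :
    eLpNorm (chaos u) q (codeLaw V d) ≤
      ENNReal.ofReal (131168 * Real.sqrt (q / d) * ∑ v, u v ^ 2) := by
  have hU0 : 0 ≤ ∑ v, u v ^ 2 := Finset.sum_nonneg fun _ _ => sq_nonneg _
  refine (eLpNorm_chaos_le_of_forall u hq (a := 1) one_pos (m := 4098 * ∑ v, u v ^ 2)
    (by positivity) fun S => ?_).trans_eq (by congr 1; ring)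
  refine (eLpNorm_norm_combo_sq_le _ hq hqd).trans (ENNReal.ofReal_le_ofReal ?_)
  exact mul_le_mul_of_nonneg_left (sum_indicator_sq_le _ _) (by norm_num)

/-- Moments of the squared inner product of a point with a combination of other points. -/
theorem eLpNorm_sq_inner_combo_le (u : V → ℝ) (v : V) (huv : u v = 0) {q : ℕ} (hq : 1 ≤ q)
    (hqd : q ≤ d) :
    eLpNorm (fun p => (inner ℝ (combo u p) (p v : EuclideanSpace ℝ (Fin d)) : ℝ) ^ 2) q
      (codeLaw V d) ≤ ENNReal.ofReal (2098176 * (q / d) * ∑ v, u v ^ 2) := by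
  classical
  have hcombo (ω ω' : V → UnitSphere d) :
      combo u (Finset.piecewise {v} ω ω') = combo u ω' := by
    unfold combo
    refine Finset.sum_congr rfl fun w _ => ?_
    by_cases h : w = v
    · subst h; simp [huv]
    · simp [h]
  refine eLpNorm_le_of_piecewise (uniformSphere d) {v}
    (g := fun ω' => 512 * (q / d) * ‖combo u ω'‖ ^ 2)
    (by fun_prop : Continuous _).measurable (fun ω' => by positivity) hq (fun ω' => ?_) ?_
  · simp only [hcombo, Finset.mem_singleton, Finset.piecewise_eq_of_mem]
    -- Since `u v = 0`, the combination is fixed once the points other than `p v` are. Squaring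
    -- calls for order `2 * q`, and `16² * 2 = 512`.
    have h1 := eLpNorm_inner_combo_le (combo u ω') (Pi.single v (1 : ℝ)) (q := 2 * q) (by omega)
    have e1 (p : V → UnitSphere d) : combo (Pi.single v (1 : ℝ)) p = p v := by
      simp [combo, Pi.single_apply]
    have e2 : ∑ w, (Pi.single v (1 : ℝ) : V → ℝ) w ^ 2 = 1 := by simp [Pi.single_apply]
    simp only [e1, e2] at h1
    refine (eLpNorm_sq_le_ofReal (by positivity) hq h1).trans_eq ?_
    congr 1
    rw [Real.sqrt_one, mul_one, mul_pow, mul_pow, Real.sq_sqrt (by positivity)]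
    push_cast; ring
  · refine (eLpNorm_const_mul_le_ofReal _ (eLpNorm_norm_combo_sq_le u hq hqd)).trans_eq ?_
    congr 1
    rw [abs_of_nonneg (by positivity)]
    ring

end Chaos

/-! ### Exact decomposition of the quartic form -/

section Quartic

variable {V : Type*} [Fintype V] {d : ℕ}

/-- The summand of the squared Frobenius norm of `P B Pᵀ`. -/
noncomputable def quarticTerm (B : V → V → ℝ) (p : V → UnitSphere d) (v w v' w' : V) : ℝ :=
  B v w * B v' w' * gram p v v' * gram p w w'

/-- The part of the quartic form with row indices in `S`, not on the diagonal, and column indices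
outside `S`. -/
noncomputable def blockChaos (B : V → V → ℝ) (S : Finset V) (p : V → UnitSphere d) : ℝ :=
  ∑ k, chaos ((S : Set V).indicator fun v => combo ((S : Set V)ᶜ.indicator (B v)) p k) p

/-- The chain terms of the quartic form. -/
noncomputable def chainSum (B : V → V → ℝ) (p : V → UnitSphere d) : ℝ :=
  ∑ x, inner ℝ (combo (fun v => B v x) p) (p x : EuclideanSpace ℝ (Fin d)) *
    inner ℝ (combo (B x) p) (p x : EuclideanSpace ℝ (Fin d))

-- Summing over the coordinate `k` turns products of coordinates of two outside combinations into
-- their inner product, that is, into Gram entries of column indices.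
open Classical in
theorem blockChaos_eq_sum (B : V → V → ℝ) (S : Finset V) (p : V → UnitSphere d) :
    blockChaos B S p = ∑ v, ∑ w, ∑ v', ∑ w',
      (if v ≠ v' then (if {v, v'} ⊆ S ∧ Disjoint S {w, w'} then (1 : ℝ) else 0) else 0) *
        quarticTerm B p v w v' w' := by
  simp only [blockChaos, chaos_eq_sum]
  rw [Finset.sum_comm]
  refine Finset.sum_congr rfl fun v _ => ?_
  rw [Finset.sum_comm]
  conv_rhs => rw [Finset.sum_comm]
  refine Finset.sum_congr rfl fun v' _ => ?_
  by_cases h : v = v'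
  · simp [h]
  simp only [ne_eq, h, not_false_eq_true, if_true]
  by_cases hv : v ∈ S
  · by_cases hv' : v' ∈ S
    · have e := inner_combo_combo ((S : Set V)ᶜ.indicator (B v)) ((S : Set V)ᶜ.indicator (B v')) p
      rw [EuclideanSpace.inner_eq_star_dotProduct] at e
      simp only [dotProduct, Pi.star_apply, star_trivial] at e
      simp only [Set.indicator_of_mem (Finset.mem_coe.2 hv),
        Set.indicator_of_mem (Finset.mem_coe.2 hv')]
      rw [← Finset.sum_mul]
      simp only [mul_comm (combo ((S : Set V)ᶜ.indicator (B v)) p _)]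
      rw [e, Finset.sum_mul]
      refine Finset.sum_congr rfl fun w _ => ?_
      rw [Finset.sum_mul]
      refine Finset.sum_congr rfl fun w' _ => ?_
      have hsub : {v, v'} ⊆ S := by simp [Finset.insert_subset_iff, hv, hv']
      by_cases hw : w ∈ S
      · simp [hw]
      · by_cases hw' : w' ∈ S
        · simp [hw']
        · simp [hw, hw', hsub, quarticTerm]; ring
    · simp [hv', Finset.insert_subset_iff]
  · simp [hv, Finset.insert_subset_iff]

theorem inner_combo_point (u : V → ℝ) (p : V → UnitSphere d) (x : V) :
    inner ℝ (combo u p) (p x : EuclideanSpace ℝ (Fin d)) = ∑ v, u v * gram p v x := by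
  simp only [combo, sum_inner, real_inner_smul_left, gram]

open Classical in
theorem chainSum_eq_sum (B : V → V → ℝ) (p : V → UnitSphere d) :
    chainSum B p = ∑ v, ∑ w, ∑ v', ∑ w',
      if v = w' then quarticTerm B p v w v' w' else 0 := by
  simp only [chainSum, inner_combo_point, Finset.sum_mul_sum, Finset.sum_ite_eq, Finset.mem_univ,
    if_true, quarticTerm]
  refine Finset.sum_congr rfl fun v _ => ?_
  rw [Finset.sum_comm]
  refine Finset.sum_congr rfl fun w _ => Finset.sum_congr rfl fun v' _ => ?_
  rw [gram_comm p v' v]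
  ring

-- The coincidences `v = w'` and `w = v'` are interchanged by swapping the two factors of the
-- quartic term, so both contribute the same chain sum.
open Classical in
theorem chainSum_eq_sum' (B : V → V → ℝ) (p : V → UnitSphere d) :
    chainSum B p = ∑ v, ∑ w, ∑ v', ∑ w',
      if w = v' then quarticTerm B p v w v' w' else 0 := by
  have h (v w : V) : ∑ v', ∑ w', (if w = v' then quarticTerm B p v w v' w' else 0) =
      ∑ w', quarticTerm B p v w w w' := by
    rw [Finset.sum_comm]
    simp only [Finset.sum_ite_eq, Finset.mem_univ, if_true]
  simp only [h]
  rw [Finset.sum_comm]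
  simp only [chainSum, inner_combo_point, Finset.sum_mul_sum, quarticTerm]
  refine Finset.sum_congr rfl fun v _ => Finset.sum_congr rfl fun w _ =>
    Finset.sum_congr rfl fun v' _ => ?_
  rw [gram_comm p v' v]
  ring

open Classical in
theorem sum_chaos_rows (B : V → V → ℝ) (p : V → UnitSphere d) :
    ∑ v, chaos (B v) p = ∑ v, ∑ w, ∑ v', ∑ w',
      if v = v' ∧ w ≠ w' then quarticTerm B p v w v' w' else 0 := by
  refine Finset.sum_congr rfl fun v _ => ?_
  rw [chaos_eq_sum]
  refine Finset.sum_congr rfl fun w _ => ?_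
  rw [Finset.sum_comm]
  refine Finset.sum_congr rfl fun w' _ => ?_
  simp only [ite_and, Finset.sum_ite_eq, Finset.mem_univ, if_true, quarticTerm, gram_self, mul_one]

open Classical in
theorem sum_chaos_cols (B : V → V → ℝ) (p : V → UnitSphere d) :
    ∑ w, chaos (fun v => B v w) p = ∑ v, ∑ w, ∑ v', ∑ w',
      if w = w' ∧ v ≠ v' then quarticTerm B p v w v' w' else 0 := by
  rw [Finset.sum_comm]
  refine Finset.sum_congr rfl fun w _ => ?_
  rw [chaos_eq_sum]
  refine Finset.sum_congr rfl fun v _ => Finset.sum_congr rfl fun v' _ => ?_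
  simp only [ite_and, Finset.sum_ite_eq, Finset.mem_univ, if_true, quarticTerm, gram_self, mul_one]

open Classical in
theorem sum_sq_eq_sum (B : V → V → ℝ) (p : V → UnitSphere d) :
    ∑ v, ∑ w, B v w ^ 2 = ∑ v, ∑ w, ∑ v', ∑ w',
      if w = w' ∧ v = v' then quarticTerm B p v w v' w' else 0 := by
  refine Finset.sum_congr rfl fun v _ => Finset.sum_congr rfl fun w _ => ?_
  simp only [ite_and, Finset.sum_ite_eq, Finset.mem_univ, if_true, quarticTerm, gram_self, mul_one,
    sq]

open Classical in
theorem sum_gram_sq_eq_sum (B : V → V → ℝ) (p : V → UnitSphere d) :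
    ∑ v, ∑ w, B v w * B w v * gram p v w ^ 2 = ∑ v, ∑ w, ∑ v', ∑ w',
      if v = w' ∧ w = v' then quarticTerm B p v w v' w' else 0 := by
  refine Finset.sum_congr rfl fun v _ => Finset.sum_congr rfl fun w _ => ?_
  simp only [ite_and, Finset.sum_ite_eq, Finset.mem_univ, if_true, quarticTerm]
  rw [gram_comm p w v]
  ring

-- Four distinct indices are separated with probability `1/16`; if `w = w'` there are only three and
-- the probability is `1/8`, hence the weight `2`.
open Classical in
theorem sixteen_mul_sum_separating (v w v' w' : V) (h : v ≠ w) (h' : v' ≠ w') :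
    16 * ∑ S : Finset V,
      (if v ≠ v' then (if {v, v'} ⊆ S ∧ Disjoint S {w, w'} then (1 : ℝ) else 0) else 0) =
    2 ^ Fintype.card V *
      (if v ≠ v' ∧ v ≠ w' ∧ w ≠ v' then (if w = w' then 2 else 1) else 0) := by
  by_cases h1 : v = v'
  · simp [h1]
  by_cases h2 : v = w'
  · have (S : Finset V) : ¬ ({v, v'} ⊆ S ∧ Disjoint S {w, w'}) := by
      rintro ⟨h3, h4⟩
      exact Finset.disjoint_left.1 h4 (h3 (by simp : v ∈ _)) (by simp [h2])
    simp only [this, if_false, ite_self, Finset.sum_const_zero, mul_zero]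
    simp [h2]
  by_cases h3 : w = v'
  · have (S : Finset V) : ¬ ({v, v'} ⊆ S ∧ Disjoint S {w, w'}) := by
      rintro ⟨h3, h4⟩
      exact Finset.disjoint_left.1 h4 (h3 (by simp : v' ∈ _)) (by simp [*])
    simp only [this, if_false, ite_self, Finset.sum_const_zero, mul_zero]
    simp [h3]
  have hd : Disjoint ({v, v'} : Finset V) {w, w'} := by
    simp [Ne.symm h, Ne.symm h2, Ne.symm h', h3]
  have hs := sum_finset_separating _ _ hd
  rw [Finset.card_pair h1] at hs
  simp only [ne_eq, h1, h2, h3, not_false_eq_true, and_self, if_true]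
  by_cases h4 : w = w'
  · subst h4
    simp only [Finset.pair_eq_singleton, Finset.card_singleton, if_true] at hs ⊢
    rw [← hs]; ring
  · rw [Finset.card_pair h4] at hs
    rw [← hs, if_neg h4]; ring

/-- Decoupling of the quartic form of a matrix with zero diagonal. -/
theorem quartic_sub_eq (B : V → V → ℝ) (hB : ∀ v, B v v = 0) (p : V → UnitSphere d) :
    ∑ v, ∑ w, ∑ v', ∑ w', quarticTerm B p v w v' w' - ∑ v, ∑ w, B v w ^ 2 =
      ((2 : ℝ) ^ Fintype.card V)⁻¹ * ∑ S : Finset V, 16 * blockChaos B S p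
        + (∑ v, chaos (B v) p + (-1 * ∑ w, chaos (fun v => B v w) p + (2 * chainSum B p
        + -1 * ∑ v, ∑ w, B v w * B w v * gram p v w ^ 2))) := by
  classical
  have hblock : ((2 : ℝ) ^ Fintype.card V)⁻¹ * ∑ S : Finset V, 16 * blockChaos B S p =
      ∑ v, ∑ w, ∑ v', ∑ w',
        (if v ≠ v' ∧ v ≠ w' ∧ w ≠ v' then (if w = w' then 2 else 1) else 0) *
          quarticTerm B p v w v' w' := by
    rw [← Finset.mul_sum]
    simp only [blockChaos_eq_sum]
    rw [Finset.sum_comm, Finset.mul_sum, Finset.mul_sum]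
    refine Finset.sum_congr rfl fun v _ => ?_
    rw [Finset.sum_comm, Finset.mul_sum, Finset.mul_sum]
    refine Finset.sum_congr rfl fun w _ => ?_
    rw [Finset.sum_comm, Finset.mul_sum, Finset.mul_sum]
    refine Finset.sum_congr rfl fun v' _ => ?_
    rw [Finset.sum_comm, Finset.mul_sum, Finset.mul_sum]
    refine Finset.sum_congr rfl fun w' _ => ?_
    rw [← Finset.sum_mul]
    by_cases h : v = w
    · simp [quarticTerm, h, hB]
    by_cases h' : v' = w'
    · simp [quarticTerm, h', hB]
    have := sixteen_mul_sum_separating v w v' w' h h'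
    rw [← mul_assoc 16, this, ← mul_assoc, inv_mul_cancel_left₀ (by positivity)]
  rw [hblock, sum_chaos_rows, sum_chaos_cols, sum_gram_sq_eq_sum, sum_sq_eq_sum B p, two_mul]
  nth_rewrite 1 [chainSum_eq_sum]
  rw [chainSum_eq_sum']
  simp only [Finset.mul_sum, ← Finset.sum_add_distrib, ← Finset.sum_sub_distrib]
  refine Finset.sum_congr rfl fun v _ => Finset.sum_congr rfl fun w _ =>
    Finset.sum_congr rfl fun v' _ => Finset.sum_congr rfl fun w' _ => ?_
  by_cases h : v = w
  · have : quarticTerm B p v w v' w' = 0 := by simp [quarticTerm, h, hB]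
    simp [this]
  by_cases h' : v' = w'
  · have : quarticTerm B p v w v' w' = 0 := by simp [quarticTerm, h', hB]
    simp [this]
  -- What remains is inclusion-exclusion on coincidences, with `v ≠ w` and `v' ≠ w'`. The column
  -- chaos is subtracted because the block average counts `w = w'` twice; the squared Gram entries
  -- are subtracted because both chain sums count `v = w'`, `w = v'`.
  generalize quarticTerm B p v w v' w' = t
  grind

end Quartic

/-! ### Moments and tails of the quartic form -/

section QuarticBound

variable {V : Type*} [Fintype V] {d : ℕ}

theorem continuous_blockChaos (B : V → V → ℝ) (S : Finset V) :
    Continuous (blockChaos (d := d) B S) := by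
  classical
  have h (v : V) (k : Fin d) : Continuous fun p : V → UnitSphere d =>
      (S : Set V).indicator (fun v => combo ((S : Set V)ᶜ.indicator (B v)) p k) v := by
    by_cases hv : v ∈ S <;> simp only [Set.indicator, Finset.mem_coe, hv, if_true, if_false] <;>
      fun_prop
  have hcombo (k : Fin d) : Continuous fun p : V → UnitSphere d => combo ((S : Set V).indicator
      fun v => combo ((S : Set V)ᶜ.indicator (B v)) p k) p :=
    continuous_finsetSum _ fun v _ => (h v k).smul (by fun_prop)
  exact continuous_finsetSum _ fun k _ => ((hcombo k).norm.pow 2).sub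
    (continuous_finsetSum _ fun v _ => (h v k).pow 2)

@[fun_prop]
theorem continuous_chainSum (B : V → V → ℝ) : Continuous (chainSum (d := d) B) := by
  unfold chainSum; fun_prop

variable [NeZero d]

/-- Given the points outside `S`, each coordinate `k` yields a quadratic chaos. Over all `k` the
squared coefficients add up to the squared norms of the outside row combinations, whose moments are
of the order of their means. -/
theorem eLpNorm_blockChaos_le (B : V → V → ℝ) (S : Finset V) {q : ℕ} (hq : 1 ≤ q) (hqd : q ≤ d) :
    eLpNorm (blockChaos B S) q (codeLaw V d) ≤
      ENNReal.ofReal (537526464 * Real.sqrt (q / d) * ∑ v, ∑ w, B v w ^ 2) := by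
  classical
  refine eLpNorm_le_of_piecewise (uniformSphere d) S
    (g := fun ω' => 131168 * Real.sqrt (q / d) *
      ∑ v, ‖combo ((S : Set V)ᶜ.indicator (B v)) ω'‖ ^ 2)
    (continuous_blockChaos B S).measurable (fun ω' => by positivity) hq (fun ω' => ?_) ?_
  · have e (ω : V → UnitSphere d) : blockChaos B S (S.piecewise ω ω') =
        ∑ k, chaos ((S : Set V).indicator
          fun v => combo ((S : Set V)ᶜ.indicator (B v)) ω' k) ω := by
      simp only [blockChaos, chaos, combo_indicator_compl_piecewise, combo_indicator_piecewise]
    simp only [e]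
    refine (eLpNorm_sum_le_ofReal hq
      (fun k _ => aestronglyMeasurable_of_continuous (by fun_prop)) (fun k _ => by positivity)
      fun k _ => eLpNorm_chaos_le _ hq hqd).trans (ENNReal.ofReal_le_ofReal ?_)
    rw [← Finset.mul_sum]
    refine mul_le_mul_of_nonneg_left ?_ (by positivity)
    rw [Finset.sum_comm]
    refine Finset.sum_le_sum fun v _ => ?_
    rw [EuclideanSpace.real_norm_sq_eq]
    refine Finset.sum_le_sum fun k _ => ?_
    by_cases hv : v ∈ S <;> simp [hv, sq_nonneg]
  · refine (eLpNorm_const_mul_le_ofReal _ (eLpNorm_sum_le_ofReal hq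
      (fun v _ => aestronglyMeasurable_of_continuous (by fun_prop)) (fun v _ => by positivity)
      fun v _ => eLpNorm_norm_combo_sq_le _ hq hqd)).trans (ENNReal.ofReal_le_ofReal ?_)
    rw [abs_of_nonneg (by positivity), ← Finset.mul_sum]
    have : ∑ v, ∑ w, (S : Set V)ᶜ.indicator (B v) w ^ 2 ≤ ∑ v, ∑ w, B v w ^ 2 :=
      Finset.sum_le_sum fun v _ => sum_indicator_sq_le _ _
    calc _ ≤ 131168 * Real.sqrt (q / d) * (4098 * ∑ v, ∑ w, B v w ^ 2) := by gcongr
      _ = _ := by ring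

/-- Each product is at most half the sum of two squares. The zero diagonal keeps `p x` out of both
combinations, which is what the squared inner product bound requires. -/
theorem eLpNorm_chainSum_le (B : V → V → ℝ) (hB : ∀ v, B v v = 0) {q : ℕ} (hq : 1 ≤ q)
    (hqd : q ≤ d) :
    eLpNorm (chainSum B) q (codeLaw V d) ≤
      ENNReal.ofReal (2098176 * (q / d) * ∑ v, ∑ w, B v w ^ 2) := by
  have h (x : V) : eLpNorm (fun p : V → UnitSphere d =>
      (inner ℝ (combo (fun v => B v x) p) (p x : EuclideanSpace ℝ (Fin d)) : ℝ) *
        inner ℝ (combo (B x) p) (p x : EuclideanSpace ℝ (Fin d))) q (codeLaw V d) ≤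
      ENNReal.ofReal (2⁻¹ * (2098176 * (q / d) * ∑ v, B v x ^ 2 +
        2098176 * (q / d) * ∑ w, B x w ^ 2)) := by
    have h1 := eLpNorm_const_mul_le_ofReal 2⁻¹ (eLpNorm_add_le_ofReal hq
      (aestronglyMeasurable_of_continuous (by fun_prop))
      (aestronglyMeasurable_of_continuous (by fun_prop)) (by positivity) (by positivity)
      (eLpNorm_sq_inner_combo_le (d := d) (fun v => B v x) x (hB x) hq hqd)
      (eLpNorm_sq_inner_combo_le (d := d) (B x) x (hB x) hq hqd))
    rw [abs_of_nonneg (by norm_num)] at h1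
    refine (eLpNorm_mono_real fun p => ?_).trans h1
    rw [Real.norm_eq_abs, abs_le]
    constructor <;>
      nlinarith [sq_nonneg ((inner ℝ (combo (fun v => B v x) p)
        (p x : EuclideanSpace ℝ (Fin d)) : ℝ) +
          inner ℝ (combo (B x) p) (p x : EuclideanSpace ℝ (Fin d))),
        sq_nonneg ((inner ℝ (combo (fun v => B v x) p) (p x : EuclideanSpace ℝ (Fin d)) : ℝ) -
          inner ℝ (combo (B x) p) (p x : EuclideanSpace ℝ (Fin d)))]
  refine (eLpNorm_sum_le_ofReal hq (fun x _ => aestronglyMeasurable_of_continuous (by fun_prop))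
    (fun x _ => by positivity) fun x _ => h x).trans_eq ?_
  congr 1
  rw [← Finset.mul_sum, Finset.sum_add_distrib, ← Finset.mul_sum, ← Finset.mul_sum,
    Finset.sum_comm]
  ring

theorem eLpNorm_sum_gram_sq_le (B : V → V → ℝ) (hB : ∀ v, B v v = 0) {q : ℕ} (hq : 1 ≤ q)
    (hqd : q ≤ d) :
    eLpNorm (fun p : V → UnitSphere d => ∑ v, ∑ w, B v w * B w v * gram p v w ^ 2) q
      (codeLaw V d) ≤ ENNReal.ofReal (2098176 * (q / d) * ∑ v, ∑ w, B v w ^ 2) := by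
  classical
  have h (v w : V) : eLpNorm (fun p : V → UnitSphere d => B v w * B w v * gram p v w ^ 2) q
      (codeLaw V d) ≤ ENNReal.ofReal (|B v w * B w v| * (2098176 * (q / d))) := by
    by_cases hvw : v = w
    · subst hvw; simp [hB]
    refine eLpNorm_const_mul_le_ofReal _ ?_
    have h1 := eLpNorm_sq_inner_combo_le (d := d) (Pi.single v (1 : ℝ)) w
      (by simp [Ne.symm hvw]) hq hqd
    have e1 (p : V → UnitSphere d) : combo (Pi.single v (1 : ℝ)) p = p v := by
      simp [combo, Pi.single_apply]
    have e2 : ∑ w, (Pi.single v (1 : ℝ) : V → ℝ) w ^ 2 = 1 := by simp [Pi.single_apply]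
    simp only [e1, e2, mul_one] at h1
    exact h1
  refine (eLpNorm_sum_le_ofReal hq (fun v _ => aestronglyMeasurable_of_continuous (by fun_prop))
    (fun v _ => by positivity) fun v _ => eLpNorm_sum_le_ofReal hq
      (fun w _ => aestronglyMeasurable_of_continuous (by fun_prop))
      (fun w _ => by positivity) fun w _ => h v w).trans (ENNReal.ofReal_le_ofReal ?_)
  simp only [← Finset.sum_mul]
  rw [mul_comm]
  refine mul_le_mul_of_nonneg_left ?_ (by positivity)
  have h2 : ∑ v, ∑ w, |B v w * B w v| ≤ ∑ v, ∑ w, (B v w ^ 2 + B w v ^ 2) / 2 := by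
    refine Finset.sum_le_sum fun v _ => Finset.sum_le_sum fun w _ => ?_
    rw [abs_mul]
    nlinarith [sq_nonneg (|B v w| - |B w v|), sq_abs (B v w), sq_abs (B w v)]
  refine h2.trans_eq ?_
  simp only [← Finset.sum_div, Finset.sum_add_distrib]
  rw [Finset.sum_comm (f := fun v w => B w v ^ 2)]
  ring

/-- Moments of the deviation of the squared Frobenius norm of `P B Pᵀ` from that of `B`. -/
theorem eLpNorm_quartic_sub_le (B : V → V → ℝ) (hB : ∀ v, B v v = 0) {q : ℕ} (hq : 1 ≤ q)
    (hqd : q ≤ d) :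
    eLpNorm (fun p : V → UnitSphere d => ∑ v, ∑ w, ∑ v', ∑ w', quarticTerm B p v w v' w' -
      ∑ v, ∑ w, B v w ^ 2) q (codeLaw V d) ≤
      ENNReal.ofReal (10 ^ 10 * Real.sqrt (q / d) * ∑ v, ∑ w, B v w ^ 2) := by
  have hblock := eLpNorm_const_mul_le_ofReal ((2 : ℝ) ^ Fintype.card V)⁻¹
    (eLpNorm_sum_le_ofReal (s := Finset.univ) hq
      (fun S _ => aestronglyMeasurable_of_continuous ((continuous_blockChaos B S).const_mul 16))
      (fun S _ => by positivity)
      fun S _ => eLpNorm_const_mul_le_ofReal 16 (eLpNorm_blockChaos_le (d := d) B S hq hqd))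
  have hrows := eLpNorm_sum_le_ofReal (s := Finset.univ) hq
    (fun v _ => aestronglyMeasurable_of_continuous (by fun_prop)) (fun v _ => by positivity)
    fun v _ => eLpNorm_chaos_le (d := d) (B v) hq hqd
  have hcols := eLpNorm_const_mul_le_ofReal (-1) (eLpNorm_sum_le_ofReal (s := Finset.univ) hq
    (fun w _ => aestronglyMeasurable_of_continuous (by fun_prop)) (fun w _ => by positivity)
    fun w _ => eLpNorm_chaos_le (d := d) (fun v => B v w) hq hqd)
  have hchain := eLpNorm_const_mul_le_ofReal 2 (eLpNorm_chainSum_le (d := d) B hB hq hqd)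
  have hgram := eLpNorm_const_mul_le_ofReal (-1) (eLpNorm_sum_gram_sq_le (d := d) B hB hq hqd)
  have hbc (S : Finset V) := continuous_blockChaos (d := d) B S
  have h := eLpNorm_add_le_ofReal hq (aestronglyMeasurable_of_continuous (by fun_prop))
    (aestronglyMeasurable_of_continuous (by fun_prop)) (by positivity) (by positivity) hblock
    (eLpNorm_add_le_ofReal hq (aestronglyMeasurable_of_continuous (by fun_prop))
      (aestronglyMeasurable_of_continuous (by fun_prop)) (by positivity) (by positivity) hrows
      (eLpNorm_add_le_ofReal hq (aestronglyMeasurable_of_continuous (by fun_prop))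
        (aestronglyMeasurable_of_continuous (by fun_prop)) (by positivity) (by positivity) hcols
        (eLpNorm_add_le_ofReal hq (aestronglyMeasurable_of_continuous (by fun_prop))
          (aestronglyMeasurable_of_continuous (by fun_prop)) (by positivity) (by positivity)
          hchain hgram)))
  simp only [quartic_sub_eq B hB]
  refine h.trans (ENNReal.ofReal_le_ofReal ?_)
  simp only [← Finset.mul_sum, Finset.sum_const, Finset.card_univ, Fintype.card_finset,
    nsmul_eq_mul, abs_neg, abs_one, one_mul]
  rw [abs_of_nonneg (by positivity : (0 : ℝ) ≤ (2 ^ Fintype.card V)⁻¹), abs_of_nonneg (by norm_num),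
    abs_of_nonneg (by norm_num), Finset.sum_comm (f := fun w v => B v w ^ 2), Nat.cast_pow,
    Nat.cast_ofNat]
  set F := ∑ v, ∑ w, B v w ^ 2
  have hF : 0 ≤ F := by positivity
  have hcancel : ((2 : ℝ) ^ Fintype.card V)⁻¹ *
      (16 * (537526464 * Real.sqrt (q / d) * (2 ^ Fintype.card V * F))) =
      16 * (537526464 * Real.sqrt (q / d) * F) := by field_simp
  rw [hcancel]
  -- The chain and Gram terms are of the smaller order `q/d`; as `q ≤ d` they fit under `√(q/d)`.
  have hle : (q : ℝ) / d ≤ Real.sqrt (q / d) := by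
    apply Real.le_sqrt_of_sq_le
    rw [sq]
    exact mul_le_of_le_one_left (by positivity)
      (div_le_one_of_le₀ (by exact_mod_cast hqd) (by positivity))
  have h1 : (q : ℝ) / d * F ≤ Real.sqrt (q / d) * F := by gcongr
  have h2 : 0 ≤ Real.sqrt (q / d) * F := by positivity
  linarith

/-- The probability that the squared Frobenius norm of `P B Pᵀ` deviates from that of `B`. -/
theorem measure_quartic_deviation_le (B : V → V → ℝ) (hB : ∀ v, B v v = 0) {q : ℕ} (hq : 1 ≤ q)
    (hqd : q ≤ d) {ε : ℝ} (hε : 10 ^ 10 * Real.sqrt (q / d) * Real.exp 1 ≤ ε) :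
    codeLaw V d {p | ε * ∑ v, ∑ w, B v w ^ 2 < |∑ v, ∑ w, ∑ v', ∑ w', quarticTerm B p v w v' w' -
      ∑ v, ∑ w, B v w ^ 2|} ≤ ENNReal.ofReal (Real.exp (-q)) := by
  have hm := eLpNorm_quartic_sub_le (d := d) B hB hq hqd
  set F := ∑ v, ∑ w, B v w ^ 2 with hF
  have hF0 : 0 ≤ F := by positivity
  have hq0 : (0 : ℝ) < q := by exact_mod_cast hq
  have hd0 : (0 : ℝ) < d := by exact_mod_cast hq.trans hqd
  have hε0 : 0 < ε := lt_of_lt_of_le (by positivity) hε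
  set f : (V → UnitSphere d) → ℝ := fun p =>
    ∑ v, ∑ w, ∑ v', ∑ w', quarticTerm B p v w v' w' - F with hf
  have hfm : AEStronglyMeasurable f (codeLaw V d) :=
    aestronglyMeasurable_of_continuous (by unfold f quarticTerm; fun_prop)
  rcases hF0.eq_or_lt with h0 | h0
  -- For `B = 0` the threshold vanishes and Markov's inequality is void, but then the deviation is
  -- almost surely zero.
  · have hz : f =ᵐ[codeLaw V d] 0 := by
      rw [← h0, mul_zero, ENNReal.ofReal_zero, nonpos_iff_eq_zero,
        eLpNorm_eq_zero_iff hfm (by simp; omega)] at hm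
      exact hm
    refine le_of_eq_of_le ?_ zero_le
    have : ∀ᵐ p ∂(codeLaw V d), ¬ (ε * F < |f p|) := by
      filter_upwards [hz] with p hp
      rw [hp, ← h0]; simp
    simpa using (ae_iff.1 this)
  -- Markov's inequality at order `q`: by `hε` the `L^q` norm is at most `exp (-1)` times the
  -- threshold, and the `q`-th power gives `exp (-q)`.
  · have hM := mul_meas_ge_le_pow_eLpNorm' (codeLaw V d) (p := q) (by simp; omega) (by simp) hfm
      (ENNReal.ofReal (ε * F))
    rw [ENNReal.toReal_natCast, ENNReal.rpow_natCast, ENNReal.rpow_natCast] at hM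
    have hpos : 0 < ε * F := by positivity
    have hsub : {p | ε * F < |f p|} ⊆ {p | ENNReal.ofReal (ε * F) ≤ ‖f p‖ₑ} := by
      intro p hp
      have hp' : ε * F < |f p| := hp
      change ENNReal.ofReal (ε * F) ≤ ‖f p‖ₑ
      rw [Real.enorm_eq_ofReal_abs]
      exact ENNReal.ofReal_le_ofReal hp'.le
    have h1 : ENNReal.ofReal (ε * F) ^ q * codeLaw V d {p | ε * F < |f p|} ≤
        ENNReal.ofReal (ε * F) ^ q * ENNReal.ofReal (Real.exp (-q)) := by
      calc _ ≤ _ := mul_le_mul_right (measure_mono hsub) _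
        _ ≤ _ := hM
        _ ≤ ENNReal.ofReal (10 ^ 10 * Real.sqrt (q / d) * F) ^ q := by gcongr
        _ ≤ _ := by
          rw [← ENNReal.ofReal_pow (by positivity), ← ENNReal.ofReal_pow (by positivity),
            ← ENNReal.ofReal_mul (by positivity)]
          apply ENNReal.ofReal_le_ofReal
          have e : Real.exp (-q) = Real.exp (-1) ^ q := by rw [← Real.exp_nat_mul]; ring_nf
          rw [e, ← mul_pow]
          refine pow_le_pow_left₀ (by positivity) ?_ q
          rw [Real.exp_neg, ← div_eq_mul_inv, le_div_iff₀ (Real.exp_pos 1)]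
          calc _ = 10 ^ 10 * Real.sqrt (q / d) * Real.exp 1 * F := by ring
            _ ≤ _ := by gcongr
    exact (ENNReal.mul_le_mul_iff_right (by simp [hpos]) (by simp)).1 h1

end QuarticBound

/-! ### Frobenius norms and the union bound -/

section Frobenius

variable {V : Type*} {d : ℕ}

theorem frobenius_norm_sq {m n : Type*} [Fintype m] [Fintype n] (A : Matrix m n ℝ) :
    ‖A‖ ^ 2 = ∑ i, ∑ j, A i j ^ 2 := by
  rw [Matrix.frobenius_norm_def, ← Real.sqrt_eq_rpow, Real.sq_sqrt (by positivity)]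
  simp

theorem sum_codeMatrix_mul (p : V → UnitSphere d) (v w : V) :
    ∑ k, codeMatrix p k v * codeMatrix p k w = gram p v w := by
  rw [gram, EuclideanSpace.inner_eq_star_dotProduct]
  simp [dotProduct, codeMatrix, mul_comm]

variable [Fintype V]

theorem frobenius_norm_sq_project (B : Matrix V V ℝ) (p : V → UnitSphere d) :
    ‖project (codeMatrix p) B‖ ^ 2 = ∑ v, ∑ w, ∑ v', ∑ w', quarticTerm B p v w v' w' := by
  rw [frobenius_norm_sq]
  have h (k l : Fin d) : project (codeMatrix p) B k l ^ 2 = ∑ v, ∑ w, ∑ v', ∑ w',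
      B v w * B v' w' * (codeMatrix p k v * codeMatrix p k v') *
        (codeMatrix p l w * codeMatrix p l w') := by
    have e : project (codeMatrix p) B k l =
        ∑ v, ∑ w, codeMatrix p k v * B v w * codeMatrix p l w := by
      rw [project, Matrix.mul_apply]
      simp only [Matrix.mul_apply, Matrix.transpose_apply, Finset.sum_mul]
      rw [Finset.sum_comm]
    rw [e, sq, Finset.sum_mul]
    refine Finset.sum_congr rfl fun v _ => ?_
    rw [Finset.sum_mul]
    refine Finset.sum_congr rfl fun w _ => ?_
    rw [Finset.mul_sum]
    refine Finset.sum_congr rfl fun v' _ => ?_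
    rw [Finset.mul_sum]
    exact Finset.sum_congr rfl fun w' _ => by ring
  have swap (f : Fin d → Fin d → V → V → V → V → ℝ) :
      ∑ k, ∑ l, ∑ v, ∑ w, ∑ v', ∑ w', f k l v w v' w' =
        ∑ v, ∑ w, ∑ v', ∑ w', ∑ k, ∑ l, f k l v w v' w' := by
    -- Fixing the two index sets lets the rewriting only push sums over `Fin d` inside sums over
    -- `V`, so it terminates.
    simp only [Finset.sum_comm (s := (Finset.univ : Finset (Fin d))) (t := (Finset.univ : Finset V))]
  simp only [h]
  rw [swap]
  refine Finset.sum_congr rfl fun v _ => Finset.sum_congr rfl fun w _ =>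
    Finset.sum_congr rfl fun v' _ => Finset.sum_congr rfl fun w' _ => ?_
  simp only [← Finset.mul_sum, ← Finset.sum_mul, sum_codeMatrix_mul, quarticTerm]

theorem project_sub (P : Matrix (Fin d) V ℝ) (A B : Matrix V V ℝ) :
    project P (A - B) = project P A - project P B := by
  simp only [project, Matrix.mul_sub, Matrix.sub_mul]

theorem continuous_norm_sq_project_sub (A B : Matrix V V ℝ) :
    Continuous fun p : V → UnitSphere d =>
      ‖project (codeMatrix p) A - project (codeMatrix p) B‖ ^ 2 := by
  simp only [← project_sub, frobenius_norm_sq_project]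
  unfold quarticTerm
  fun_prop

/-- The squared Frobenius distances of a finite family of matrices with equal diagonals are
simultaneously preserved by a random projection with high probability. -/
theorem measure_distortion_le [NeZero d] {N : ℕ} (A : Fin N → Matrix V V ℝ)
    (hA : ∀ i j v, A i v v = A j v v) {q : ℕ} (hq : 1 ≤ q) (hqd : q ≤ d) {ε : ℝ}
    (hε : 10 ^ 10 * Real.sqrt (q / d) * Real.exp 1 ≤ ε) :
    codeLaw V d {p | ∀ i j,
      (1 - ε) * ‖A i - A j‖ ^ 2 ≤ ‖project (codeMatrix p) (A i) - project (codeMatrix p) (A j)‖ ^ 2 ∧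
      ‖project (codeMatrix p) (A i) - project (codeMatrix p) (A j)‖ ^ 2 ≤
        (1 + ε) * ‖A i - A j‖ ^ 2}ᶜ ≤ ENNReal.ofReal (N ^ 2 * Real.exp (-q)) := by
  have hsub : {p : V → UnitSphere d | ∀ i j,
      (1 - ε) * ‖A i - A j‖ ^ 2 ≤ ‖project (codeMatrix p) (A i) - project (codeMatrix p) (A j)‖ ^ 2 ∧
      ‖project (codeMatrix p) (A i) - project (codeMatrix p) (A j)‖ ^ 2 ≤
        (1 + ε) * ‖A i - A j‖ ^ 2}ᶜ ⊆ ⋃ ij ∈ (Finset.univ : Finset (Fin N × Fin N)),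
      {p | ε * ∑ v, ∑ w, (A ij.1 - A ij.2) v w ^ 2 <
        |∑ v, ∑ w, ∑ v', ∑ w', quarticTerm (A ij.1 - A ij.2) p v w v' w' -
          ∑ v, ∑ w, (A ij.1 - A ij.2) v w ^ 2|} := by
    intro p hp
    rw [Set.mem_compl_iff, Set.mem_ofPred_eq] at hp
    push Not at hp
    obtain ⟨i, j, hij⟩ := hp
    refine Set.mem_biUnion (x := (i, j)) (by simp) ?_
    rw [Set.mem_ofPred_eq, ← frobenius_norm_sq_project, ← frobenius_norm_sq, project_sub]
    by_contra hcon
    rw [not_lt, abs_le] at hcon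
    have := hij (by linarith [hcon.1])
    linarith [hcon.2]
  refine (measure_mono hsub).trans ((measure_biUnion_finset_le _ _).trans ?_)
  refine (Finset.sum_le_sum fun ij _ => measure_quartic_deviation_le (d := d)
    (fun v w => (A ij.1 - A ij.2) v w) (fun v => ?_) hq hqd hε).trans_eq ?_
  · rw [Matrix.sub_apply, hA ij.1 ij.2, sub_self]
  · rw [Finset.sum_const, Finset.card_univ, Fintype.card_prod, Fintype.card_fin, nsmul_eq_mul,
      ENNReal.ofReal_mul (by positivity), ENNReal.ofReal_pow (by positivity),
      ENNReal.ofReal_natCast]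
    push_cast
    ring

end Frobenius

/-! ### Choice of parameters and conclusion -/

/-- A moment order that beats the union bound and is compatible with the dimension. -/
theorem exists_moment_order {ε δ : ℝ} (hε : 0 < ε) (hε1 : ε < 1) (hδ : 0 < δ) (hδ1 : δ < 1)
    {N d : ℕ} (hN : 2 ≤ N)
    (hd : 10 ^ 22 * (Real.log N + Real.log (1 / δ)) / ε ^ 2 ≤ (d : ℝ)) :
    ∃ q : ℕ, 1 ≤ q ∧ q ≤ d ∧ 10 ^ 10 * Real.sqrt (q / d) * Real.exp 1 ≤ ε ∧
      N ^ 2 * Real.exp (-q) ≤ δ := by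
  have hN0 : (0 : ℝ) < N := by positivity
  have hlogδ : 0 < Real.log (1 / δ) := Real.log_pos (by rw [lt_div_iff₀ hδ]; linarith)
  have hlogN : (1 / 2 : ℝ) ≤ Real.log N := by
    have h1 : Real.log 2 ≤ Real.log N := Real.log_le_log (by norm_num) (by exact_mod_cast hN)
    linarith [Real.log_two_gt_d9]
  set M : ℝ := 2 * Real.log N + Real.log (1 / δ) with hM
  have hM0 : 0 < M := by positivity
  have hqM : M ≤ (⌈M⌉₊ : ℝ) := Nat.le_ceil M
  have hqM' : (⌈M⌉₊ : ℝ) < M + 1 := Nat.ceil_lt_add_one hM0.le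
  have hL0 : 0 < Real.log N + Real.log (1 / δ) := by positivity
  have hd0 : (0 : ℝ) < d := lt_of_lt_of_le (by positivity) hd
  -- As `log N ≥ 1/2`, the rounding error `1` is at most `2 log N`, so the order is at most `4 (log
  -- N + log (1/δ))` and its ratio to `d` at most `4 ε² / 10²²`.
  have hqd : (⌈M⌉₊ : ℝ) / d ≤ (2 * ε / 10 ^ 11) ^ 2 := by
    rw [div_le_iff₀ hd0]
    rw [div_le_iff₀ (by positivity)] at hd
    rw [div_pow, mul_pow, div_mul_eq_mul_div, le_div_iff₀ (by positivity)]
    nlinarith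
  refine ⟨⌈M⌉₊, Nat.one_le_ceil_iff.2 hM0, ?_, ?_, ?_⟩
  · have h1 : (⌈M⌉₊ : ℝ) / d ≤ 1 := hqd.trans (pow_le_one₀ (by positivity) (by
      rw [div_le_one (by positivity)]; linarith))
    rw [div_le_one hd0] at h1
    exact_mod_cast h1
  · have h1 : Real.sqrt (⌈M⌉₊ / d) ≤ 2 * ε / 10 ^ 11 := Real.sqrt_le_iff.2 ⟨by positivity, hqd⟩
    calc _ ≤ 10 ^ 10 * (2 * ε / 10 ^ 11) * 3 := by
          gcongr
          linarith [Real.exp_one_lt_d9]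
      _ ≤ ε := by linarith
  · calc _ ≤ N ^ 2 * Real.exp (-M) := by gcongr
      _ = δ := by
        rw [hM, neg_add, Real.exp_add, Real.log_div one_ne_zero hδ.ne', Real.log_one, zero_sub,
          neg_neg, Real.exp_log hδ, Real.exp_neg, two_mul, Real.exp_add, Real.exp_log hN0]
        field_simp

end GraphJL

/-- Random projections are a Johnson-Lindenstrauss map for finite families of loopless directed
graphs on a common finite vertex set. All matrix norms are Frobenius norms. -/
theorem mainTheorem1 :
    ∃ C : ℝ, 0 < C ∧
      ∀ (ε δ : ℝ), 0 < ε → ε < 1 → 0 < δ → δ < 1 →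
      ∀ (N d : ℕ), 1 ≤ N → C * (Real.log N + Real.log (1 / δ)) / ε ^ 2 ≤ (d : ℝ) →
      ∀ (V : Type*) [Fintype V] (G : Fin N → Digraph V),
        (∀ i v, ¬ (G i).Adj v v) →
      ∀ (Ω : Type*) [MeasurableSpace Ω] (μ : MeasureTheory.Measure Ω)
        [MeasureTheory.IsProbabilityMeasure μ] (p : V → Ω → GraphJL.UnitSphere d),
        (∀ v, ProbabilityTheory.HasLaw (p v) (GraphJL.uniformSphere d) μ) →
        ProbabilityTheory.iIndepFun p μ →
        1 - δ ≤ μ.real {ω | ∀ i j : Fin N,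
          (1 - ε) * ‖GraphJL.adjMatrix (G i) - GraphJL.adjMatrix (G j)‖ ^ 2
              ≤ ‖GraphJL.project (GraphJL.codeMatrix fun v => p v ω) (GraphJL.adjMatrix (G i))
                  - GraphJL.project (GraphJL.codeMatrix fun v => p v ω)
                      (GraphJL.adjMatrix (G j))‖ ^ 2 ∧
          ‖GraphJL.project (GraphJL.codeMatrix fun v => p v ω) (GraphJL.adjMatrix (G i))
                  - GraphJL.project (GraphJL.codeMatrix fun v => p v ω)
                      (GraphJL.adjMatrix (G j))‖ ^ 2
              ≤ (1 + ε) * ‖GraphJL.adjMatrix (G i) - GraphJL.adjMatrix (G j)‖ ^ 2} := by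
  refine ⟨10 ^ 22, by norm_num, ?_⟩
  intro ε δ hε hε1 hδ hδ1 N d hN hd V _ G hG Ω _ μ _ p hp hind
  -- For `N = 1` there is no lower bound on `log N` to absorb the rounding, but the only pair is `i
  -- = j` and both sides vanish.
  rcases hN.eq_or_lt with rfl | hN2
  · have : ∀ ω (i j : Fin 1),
        (1 - ε) * ‖GraphJL.adjMatrix (G i) - GraphJL.adjMatrix (G j)‖ ^ 2
              ≤ ‖GraphJL.project (GraphJL.codeMatrix fun v => p v ω) (GraphJL.adjMatrix (G i))
                  - GraphJL.project (GraphJL.codeMatrix fun v => p v ω)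
                      (GraphJL.adjMatrix (G j))‖ ^ 2 ∧
          ‖GraphJL.project (GraphJL.codeMatrix fun v => p v ω) (GraphJL.adjMatrix (G i))
                  - GraphJL.project (GraphJL.codeMatrix fun v => p v ω)
                      (GraphJL.adjMatrix (G j))‖ ^ 2
              ≤ (1 + ε) * ‖GraphJL.adjMatrix (G i) - GraphJL.adjMatrix (G j)‖ ^ 2 := by
      intro ω i j
      rw [Subsingleton.elim i j]
      simp
    rw [Set.eq_univ_of_forall (s := {ω | _}) this, MeasureTheory.probReal_univ]
    linarith
  obtain ⟨q, hq, hqd, hqε, hqδ⟩ := GraphJL.exists_moment_order hε hε1 hδ hδ1 hN2 hd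
  have : NeZero d := ⟨by omega⟩
  have hmeas : ∀ v, AEMeasurable (p v) μ := fun v => (hp v).aemeasurable
  -- Independence and the marginal laws identify the joint law with the product measure, where the
  -- estimates live.
  have hmap : μ.map (fun ω v => p v ω) = GraphJL.codeLaw V d := by
    rw [(ProbabilityTheory.iIndepFun_iff_map_fun_eq_pi_map hmeas).1 hind]
    congr 1
    ext1 v
    exact (hp v).map_eq
  set E : Set (V → GraphJL.UnitSphere d) := {p | ∀ i j,
      (1 - ε) * ‖GraphJL.adjMatrix (G i) - GraphJL.adjMatrix (G j)‖ ^ 2 ≤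
        ‖GraphJL.project (GraphJL.codeMatrix p) (GraphJL.adjMatrix (G i)) -
          GraphJL.project (GraphJL.codeMatrix p) (GraphJL.adjMatrix (G j))‖ ^ 2 ∧
      ‖GraphJL.project (GraphJL.codeMatrix p) (GraphJL.adjMatrix (G i)) -
          GraphJL.project (GraphJL.codeMatrix p) (GraphJL.adjMatrix (G j))‖ ^ 2 ≤
        (1 + ε) * ‖GraphJL.adjMatrix (G i) - GraphJL.adjMatrix (G j)‖ ^ 2} with hE
  have hEm : MeasurableSet E := by
    apply IsClosed.measurableSet
    simp only [hE, Set.ofPred_forall, Set.ofPred_and]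
    exact isClosed_iInter fun i => isClosed_iInter fun j =>
      (isClosed_le continuous_const (GraphJL.continuous_norm_sq_project_sub _ _)).inter
        (isClosed_le (GraphJL.continuous_norm_sq_project_sub _ _) continuous_const)
  have hEc : GraphJL.codeLaw V d Eᶜ ≤ ENNReal.ofReal δ :=
    (GraphJL.measure_distortion_le (fun i => GraphJL.adjMatrix (G i))
      (fun i j v => by simp [GraphJL.adjMatrix, hG]) hq hqd hqε).trans
      (ENNReal.ofReal_le_ofReal hqδ)
  have hreal : (GraphJL.codeLaw V d).real Eᶜ ≤ δ := ENNReal.toReal_le_of_le_ofReal hδ.le hEc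
  rw [MeasureTheory.probReal_compl_eq_one_sub hEm, ← hmap,
    MeasureTheory.map_measureReal_apply_of_aemeasurable (aemeasurable_pi_lambda _ hmeas) hEm]
    at hreal
  change 1 - δ ≤ μ.real ((fun ω v => p v ω) ⁻¹' E)
  linarith
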